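/- Let $n\ge 2$ and $m\in\{n,n+1\}$. Let $U\subset\mathbb{R}^n\times\mathbb{R}^n$ be a nonempty open set with (Darboux) coordinates $(\lambda,\mu)$, on which $\lambda_1,\dots,\lambda_n$ are pairwise distinct, and let $\{f,g\}=\sum_{i=1}^n\left(\frac{\partial f}{\partial \mu_i}\frac{\partial g}{\partial\lambda_i}-\frac{\partial f}{\partial \lambda_i}\frac{\partial g}{\partial\mu_i}\right)$ on $C^\infty(U)$, so that $\{\mu_i,\lambda_j\}=\delta_{ij}$. The quasi-Stäckel Hamiltonians $h_1,\dots,h_n\in C^\infty(U)$ are the solution of the linear system $$\sum_{j=1}^n\lambda_i^{n-j}h_j=\tfrac12\lambda_i^m\mu_i^2+w_i,\qquad i=1,\dots,n,$$ where $$w_i=-\lambda_i^{n-1}\sum_{k\ne i}\frac{\lambda_i\mu_i-\lambda_k\mu_k}{\lambda_i-\lambda_k}+(n-1)\lambda_i^{n-1}\mu_i\quad\text{if } m=n,$$ $$w_i=-\lambda_i^{n-1}\sum_{k\ne i}\frac{\lambda_i^2\mu_i-\lambda_k^2\mu_k}{\lambda_i-\lambda_k}+(n-1)\lambda_i^{n}\mu_i\quad\text{if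 } m=n+1.$$ Then $\mathfrak g=\mathrm{span}\{h_1,\dots,h_n\}$ is a Lie subalgebra of $(C^\infty(U),\{\cdot,\cdot\})$ with basis $h_1,\dots,h_n$. Put $h'_1=h_1$ and $h'_i=h_{n-i+2}$ for $i=2,\dots,n$, let $d_a=\lfloor m/2\rfloor+1$, and let $d_c=1$ if $m=n\geq 3$, $d_c=2$ if $m=n=2$, $d_c=2$ if $m=n+1$ and $n\ne3$, and $d_c=3$ if $(n,m)=(3,4)$. Then: 1. The basis $h'_1,\dots,h'_n$ satisfies the following conditions: $1\le d_c\le d_a\le n$; $\mathrm{span}\{h'_1,\dots,h'_{d_c}\}$ is the center of $\mathfrak g$; $\mathrm{span}\{h'_1,\dots,h'_{d_a}\}$ is an Abelian subalgebra of $\mathfrak g$; and $\{h'_i,h'_j\}\in\mathrm{span}\{h'_1,\dots,h'_{\min(i,j)-1}\}$ for all $i,j\le n-1$. 2. There is a unique family $H'_i\in\mathfrak g[t'_{d_c+1},\dots,t'_{i-1}]$, $i=1,\dots,n$, such that $$\frac{\partial H'_i}{\partial t'_j}-\frac{\partial H'_j}{\partial t'_i}+\{H'_i,H'_j\}=0\quad\text{for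 all } i,j=1,\dots,n\qquad(\ast)$$ (the Frobenius condition), $H'_i=h'_i$ for $i\le d_a$, and $H'_i|_{t'=0}=h'_i$ for $i>d_a$. 3. Return to the original ordering, for the Hamiltonians and for the times alike: $H_1=H'_1$, $t_1=t'_1$ and $H_{n-i+2}=H'_i$, $t_{n-i+2}=t'_i$ for $i=2,\dots,n$. Then $H_1,\dots,H_n$ satisfy the Frobenius condition with respect to $t_1,\dots,t_n$, and, with the convention $\mathrm{ad}_f\,g=\{g,f\}$, there are real constants $\alpha_{ir_1\cdots r_k}$ ($k\ge2$) such that for $i=1,\dots,n$ $$H_i=h_i-\sum_{r_1=i+1}^n(\mathrm{ad}_{h_{r_1}}h_i)\,t_{r_1}+\sum_{k\ge2}(-1)^k\sum_{i<r_1\le r_2\le\cdots\le r_k\le n}\alpha_{ir_1\cdots r_k}\,(\mathrm{ad}_{h_{r_k}}\cdots\mathrm{ad}_{h_{r_1}}h_i)\,t_{r_1}\cdots t_{r_k},$$ where the sum is finite: $\mathrm{ad}_{h_{r_k}}\cdots\mathrm{ad}_{h_{r_1}}h_i=0$ for $k>n$. 4. The constants are determined by the Frobenius condition: if the functions given by this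 formula with real constants $\beta_{ir_1\cdots r_k}$ in place of $\alpha_{ir_1\cdots r_k}$ satisfy the Frobenius condition, then $\beta_{ir_1\cdots r_k}=\alpha_{ir_1\cdots r_k}$ for all $k\ge2$ and $i<r_1\le\cdots\le r_k\le n$ with $\mathrm{ad}_{h_{r_k}}\cdots\mathrm{ad}_{h_{r_1}}h_i\neq0$. -/

import Mathlib

open scoped TensorProduct ContDiff

noncomputable section

/-! ### The Lie algebra of smooth functions on an open subset of the phase space -/

/-- Points `(lam, mu)` of `ℝⁿ × ℝⁿ`, i.e. values of a system of Darboux coordinates. -/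
abbrev PhaseSpace (n : ℕ) : Type := (Fin n → ℝ) × (Fin n → ℝ)

/-- The space of smooth real functions on the open set `U`. A function on `U` is represented by
its extension by zero, so that equality in this space is equality on `U`. -/
def SmoothFun {n : ℕ} (U : TopologicalSpace.Opens (PhaseSpace n)) :
    Submodule ℝ (PhaseSpace n → ℝ) where
  carrier := {f | ContDiffOn ℝ ∞ f U ∧ ∀ x, x ∉ U → f x = 0}
  add_mem' := by
    rintro f g ⟨hf, hf0⟩ ⟨hg, hg0⟩
    exact ⟨hf.add hg, fun x hx => by simp [hf0 x hx, hg0 x hx]⟩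
  zero_mem' := ⟨contDiffOn_const, fun _ _ => rfl⟩
  smul_mem' := by
    rintro c f ⟨hf, hf0⟩
    exact ⟨contDiffOn_const.smul hf, fun x hx => by simp [hf0 x hx]⟩

/-- `∂f/∂lam_i`. -/
def dLam {n : ℕ} (i : Fin n) (f : PhaseSpace n → ℝ) (x : PhaseSpace n) : ℝ :=
  fderiv ℝ f x (Pi.single i 1, 0)

/-- `∂f/∂mu_i`. -/
def dMu {n : ℕ} (i : Fin n) (f : PhaseSpace n → ℝ) (x : PhaseSpace n) : ℝ :=
  fderiv ℝ f x (0, Pi.single i 1)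

/-- The canonical Poisson bracket on `U`, normalised by `{mu_i, lam_j} = δ_ij`. -/
def poissonFun {n : ℕ} (U : TopologicalSpace.Opens (PhaseSpace n)) (f g : PhaseSpace n → ℝ) :
    PhaseSpace n → ℝ :=
  (U : Set (PhaseSpace n)).indicator
    fun x => ∑ i, (dMu i f x * dLam i g x - dLam i f x * dMu i g x)

section Poisson

variable {n : ℕ} {U : TopologicalSpace.Opens (PhaseSpace n)}

theorem SmoothFun.contDiffAt (f : SmoothFun U) {x : PhaseSpace n} (hx : x ∈ U) :
    ContDiffAt ℝ ∞ (f : PhaseSpace n → ℝ) x :=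
  f.2.1.contDiffAt (U.isOpen.mem_nhds hx)

theorem SmoothFun.differentiableAt (f : SmoothFun U) {x : PhaseSpace n} (hx : x ∈ U) :
    DifferentiableAt ℝ (f : PhaseSpace n → ℝ) x :=
  (SmoothFun.contDiffAt f hx).differentiableAt (by simp)

theorem SmoothFun.contDiffOn_fderiv_apply (f : SmoothFun U) (v : PhaseSpace n) :
    ContDiffOn ℝ ∞ (fun x => fderiv ℝ (f : PhaseSpace n → ℝ) x v) U :=
  (f.2.1.fderiv_of_isOpen U.isOpen (by simp)).clm_apply contDiffOn_const

theorem poissonFun_mem (f g : SmoothFun U) : poissonFun U f g ∈ SmoothFun U := by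
  refine ⟨?_, fun x hx => Set.indicator_of_notMem (by simpa using hx) _⟩
  refine ContDiffOn.congr (f := fun x => ∑ i, (dMu i f x * dLam i g x - dLam i f x * dMu i g x))
    ?_ (fun x hx => by rw [poissonFun, Set.indicator_of_mem hx])
  refine ContDiffOn.sum fun i _ => ?_
  exact ((SmoothFun.contDiffOn_fderiv_apply f _).mul (SmoothFun.contDiffOn_fderiv_apply g _)).sub
    ((SmoothFun.contDiffOn_fderiv_apply f _).mul (SmoothFun.contDiffOn_fderiv_apply g _))

instance SmoothFun.instBracket : Bracket (SmoothFun U) (SmoothFun U) :=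
  ⟨fun f g => ⟨poissonFun U f g, poissonFun_mem f g⟩⟩

theorem SmoothFun.lie_apply (f g : SmoothFun U) {x : PhaseSpace n} (hx : x ∈ U) :
    (⁅f, g⁆ : SmoothFun U).1 x = ∑ i, (dMu i f x * dLam i g x - dLam i f x * dMu i g x) := by
  have hx' : x ∈ (U : Set (PhaseSpace n)) := hx
  change poissonFun U f g x = _
  rw [poissonFun, Set.indicator_of_mem hx']

theorem SmoothFun.ext_on {f g : SmoothFun U} (h : ∀ x ∈ U, f.1 x = g.1 x) : f = g := by
  apply Subtype.ext
  funext x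
  by_cases hx : x ∈ U
  · exact h x hx
  · rw [f.2.2 x hx, g.2.2 x hx]

theorem SmoothFun.fderiv_add_apply (f g : SmoothFun U) {x : PhaseSpace n} (hx : x ∈ U)
    (v : PhaseSpace n) :
    fderiv ℝ (f + g : SmoothFun U).1 x v = fderiv ℝ f.1 x v + fderiv ℝ g.1 x v := by
  have : (f + g : SmoothFun U).1 = f.1 + g.1 := rfl
  rw [this, fderiv_add (SmoothFun.differentiableAt f hx) (SmoothFun.differentiableAt g hx)]
  rfl

theorem SmoothFun.fderiv_smul_apply (c : ℝ) (f : SmoothFun U) {x : PhaseSpace n} (hx : x ∈ U)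
    (v : PhaseSpace n) :
    fderiv ℝ (c • f : SmoothFun U).1 x v = c * fderiv ℝ f.1 x v := by
  have : (c • f : SmoothFun U).1 = c • f.1 := rfl
  rw [this, fderiv_const_smul (SmoothFun.differentiableAt f hx)]
  rfl

theorem SmoothFun.fderiv_fderiv (f : SmoothFun U) {x : PhaseSpace n} (hx : x ∈ U)
    (v w : PhaseSpace n) :
    fderiv ℝ (fun y => fderiv ℝ f.1 y v) x w = fderiv ℝ (fderiv ℝ f.1) x w v := by
  have hd : DifferentiableAt ℝ (fderiv ℝ f.1) x :=
    ((SmoothFun.contDiffAt f hx).fderiv_right (m := 1) (by norm_cast)).differentiableAt (by simp)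
  rw [fderiv_clm_apply hd (differentiableAt_const v)]
  simp

theorem SmoothFun.fderiv_comm (f : SmoothFun U) {x : PhaseSpace n} (hx : x ∈ U)
    (v w : PhaseSpace n) :
    fderiv ℝ (fderiv ℝ f.1) x w v = fderiv ℝ (fderiv ℝ f.1) x v w := by
  refine (SmoothFun.contDiffAt f hx).isSymmSndFDerivAt ?_ w v
  simp only [minSmoothness_of_isRCLikeNormedField]
  norm_cast

theorem SmoothFun.fderiv_lie (f g : SmoothFun U) {x : PhaseSpace n} (hx : x ∈ U)
    (v : PhaseSpace n) :
    fderiv ℝ (⁅f, g⁆ : SmoothFun U).1 x v = ∑ i,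
      (fderiv ℝ (fderiv ℝ f.1) x v (0, Pi.single i 1) * dLam i g x
        + dMu i f x * fderiv ℝ (fderiv ℝ g.1) x v (Pi.single i 1, 0)
        - fderiv ℝ (fderiv ℝ f.1) x v (Pi.single i 1, 0) * dMu i g x
        - dLam i f x * fderiv ℝ (fderiv ℝ g.1) x v (0, Pi.single i 1)) := by
  have hev : (⁅f, g⁆ : SmoothFun U).1 =ᶠ[nhds x]
      fun x => ∑ i, (dMu i f x * dLam i g x - dLam i f x * dMu i g x) := by
    filter_upwards [U.isOpen.mem_nhds hx] with y hy using SmoothFun.lie_apply f g hy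
  have hd : ∀ (f : SmoothFun U) (w : PhaseSpace n),
      DifferentiableAt ℝ (fun y => fderiv ℝ f.1 y w) x := fun f w =>
    ((SmoothFun.contDiffOn_fderiv_apply f w).contDiffAt (U.isOpen.mem_nhds hx)).differentiableAt (by simp)
  have hmu : ∀ (f : SmoothFun U) (i : Fin n), DifferentiableAt ℝ (dMu i f.1) x :=
    fun f i => hd f _
  have hla : ∀ (f : SmoothFun U) (i : Fin n), DifferentiableAt ℝ (dLam i f.1) x :=
    fun f i => hd f _
  have emu : ∀ (f : SmoothFun U) (i : Fin n),
      fderiv ℝ (dMu i f.1) x v = fderiv ℝ (fderiv ℝ f.1) x v (0, Pi.single i 1) :=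
    fun f i => SmoothFun.fderiv_fderiv f hx _ _
  have ela : ∀ (f : SmoothFun U) (i : Fin n),
      fderiv ℝ (dLam i f.1) x v = fderiv ℝ (fderiv ℝ f.1) x v (Pi.single i 1, 0) :=
    fun f i => SmoothFun.fderiv_fderiv f hx _ _
  rw [hev.fderiv_eq, fderiv_fun_sum (fun i _ =>
    ((hmu f i).fun_mul (hla g i)).fun_sub ((hla f i).fun_mul (hmu g i))),
    _root_.sum_apply]
  refine Finset.sum_congr rfl fun i _ => ?_
  rw [fderiv_fun_sub ((hmu f i).fun_mul (hla g i)) ((hla f i).fun_mul (hmu g i)),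
    fderiv_fun_mul (hmu f i) (hla g i), fderiv_fun_mul (hla f i) (hmu g i)]
  simp only [_root_.sub_apply, _root_.add_apply,
    _root_.smul_apply, smul_eq_mul, emu, ela]
  ring

/-- Smooth functions on `U` form a Lie ring under the Poisson bracket. -/
instance SmoothFun.instLieRing : LieRing (SmoothFun U) where
  add_lie f g k := SmoothFun.ext_on fun x hx => by
    have : (⁅f, k⁆ + ⁅g, k⁆ : SmoothFun U).1 x = (⁅f, k⁆ : SmoothFun U).1 x
      + (⁅g, k⁆ : SmoothFun U).1 x := rfl
    rw [this]
    simp only [SmoothFun.lie_apply _ _ hx, dMu, dLam, SmoothFun.fderiv_add_apply _ _ hx,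
      ← Finset.sum_add_distrib]
    exact Finset.sum_congr rfl fun i _ => by ring
  lie_add f g k := SmoothFun.ext_on fun x hx => by
    have : (⁅f, g⁆ + ⁅f, k⁆ : SmoothFun U).1 x = (⁅f, g⁆ : SmoothFun U).1 x
      + (⁅f, k⁆ : SmoothFun U).1 x := rfl
    rw [this]
    simp only [SmoothFun.lie_apply _ _ hx, dMu, dLam, SmoothFun.fderiv_add_apply _ _ hx,
      ← Finset.sum_add_distrib]
    exact Finset.sum_congr rfl fun i _ => by ring
  lie_self f := SmoothFun.ext_on fun x hx => by
    rw [SmoothFun.lie_apply _ _ hx]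
    exact Finset.sum_eq_zero fun i _ => by ring
  leibniz_lie f g k := SmoothFun.ext_on fun x hx => by
    have h0 : (⁅⁅f, g⁆, k⁆ + ⁅g, ⁅f, k⁆⁆ : SmoothFun U).1 x = (⁅⁅f, g⁆, k⁆ : SmoothFun U).1 x
      + (⁅g, ⁅f, k⁆⁆ : SmoothFun U).1 x := rfl
    rw [h0, ← sub_eq_zero]
    simp only [SmoothFun.lie_apply _ _ hx]
    have emu : ∀ (a b : SmoothFun U) (i : Fin n), dMu i (⁅a, b⁆ : SmoothFun U).1 x = _ :=
      fun a b i => SmoothFun.fderiv_lie a b hx (0, Pi.single i 1)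
    have ela : ∀ (a b : SmoothFun U) (i : Fin n), dLam i (⁅a, b⁆ : SmoothFun U).1 x = _ :=
      fun a b i => SmoothFun.fderiv_lie a b hx (Pi.single i 1, 0)
    simp only [emu, ela, Finset.mul_sum, Finset.sum_mul, ← Finset.sum_sub_distrib,
      ← Finset.sum_add_distrib]
    rw [← add_self_eq_zero]
    nth_rewrite 2 [Finset.sum_comm]
    rw [← Finset.sum_add_distrib]
    refine Finset.sum_eq_zero fun i _ => ?_
    rw [← Finset.sum_add_distrib]
    refine Finset.sum_eq_zero fun j _ => ?_
    have c := fun (a : SmoothFun U) v w => SmoothFun.fderiv_comm a hx v w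
    rw [c f (Pi.single i 1, 0) (Pi.single j 1, 0), c g (Pi.single i 1, 0) (Pi.single j 1, 0),
      c k (Pi.single i 1, 0) (Pi.single j 1, 0), c f (0, Pi.single i 1) (0, Pi.single j 1),
      c g (0, Pi.single i 1) (0, Pi.single j 1), c k (0, Pi.single i 1) (0, Pi.single j 1),
      c f (0, Pi.single i 1) (Pi.single j 1, 0), c g (0, Pi.single i 1) (Pi.single j 1, 0),
      c k (0, Pi.single i 1) (Pi.single j 1, 0), c f (Pi.single i 1, 0) (0, Pi.single j 1),
      c g (Pi.single i 1, 0) (0, Pi.single j 1), c k (Pi.single i 1, 0) (0, Pi.single j 1)]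
    ring

instance SmoothFun.instLieAlgebra : LieAlgebra ℝ (SmoothFun U) where
  lie_smul c f g := SmoothFun.ext_on fun x hx => by
    have : (c • ⁅f, g⁆ : SmoothFun U).1 x = c * (⁅f, g⁆ : SmoothFun U).1 x := rfl
    rw [this]
    simp only [SmoothFun.lie_apply _ _ hx, dMu, dLam, SmoothFun.fderiv_smul_apply _ _ hx,
      Finset.mul_sum]
    exact Finset.sum_congr rfl fun i _ => by ring

end Poisson

/-! ### Quasi-Stäckel Hamiltonians

All indices `1, …, n` of the mathematical text become `0, …, n - 1` in `Fin n`. -/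

/-- The matrix `(lam_i ^ (n - j))` of the linear system of quasi-separation relations
(the column `j : Fin n` is the `(j + 1)`-st one). -/
def sepMatrix {n : ℕ} (x : PhaseSpace n) : Matrix (Fin n) (Fin n) ℝ :=
  Matrix.of fun i j => x.1 i ^ (n - 1 - (j : ℕ))

/-- The part `∑ₖ v_ik(lam) mu_k` of the quasi-separation relations linear in the momenta,
for `m = 0`, for `1 ≤ m ≤ n`, and for `m = n + 1`. -/
def sepLinear {n : ℕ} (m : ℕ) (x : PhaseSpace n) (i : Fin n) : ℝ :=
  if m = 0 then
    - ∑ k ∈ Finset.univ.erase i, (x.2 i - x.2 k) / (x.1 i - x.1 k)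
  else if m ≤ n then
    - x.1 i ^ (m - 1) *
        ∑ k ∈ Finset.univ.erase i, (x.1 i * x.2 i - x.1 k * x.2 k) / (x.1 i - x.1 k)
      + ((m : ℝ) - 1) * x.1 i ^ (m - 1) * x.2 i
  else
    - x.1 i ^ (n - 1) *
        ∑ k ∈ Finset.univ.erase i, (x.1 i ^ 2 * x.2 i - x.1 k ^ 2 * x.2 k) / (x.1 i - x.1 k)
      + ((n : ℝ) - 1) * x.1 i ^ n * x.2 i

/-- The right-hand side of the quasi-separation relations. -/
def sepRhs {n : ℕ} (m : ℕ) (x : PhaseSpace n) (i : Fin n) : ℝ :=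
  (1 / 2) * x.1 i ^ m * x.2 i ^ 2 + sepLinear m x i

/-- The solution `(h_1, …, h_n)` of the quasi-separation relations at the point `x`. -/
def sepSolution {n : ℕ} (m : ℕ) (x : PhaseSpace n) : Fin n → ℝ :=
  Matrix.mulVec (sepMatrix x)⁻¹ (sepRhs m x)

theorem sepMatrix_isUnit_det {n : ℕ} {x : PhaseSpace n} (hx : Function.Injective x.1) :
    IsUnit (sepMatrix x).det := by
  have h : sepMatrix x = (Matrix.vandermonde x.1).submatrix id Fin.revPerm := by
    ext i j
    simp only [sepMatrix, Matrix.of_apply, Matrix.submatrix_apply, Matrix.vandermonde_apply, id,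
      Fin.revPerm_apply, Fin.val_rev]
    congr 1
    omega
  rw [h, Matrix.det_permute', isUnit_iff_ne_zero]
  refine mul_ne_zero ?_ (Matrix.det_vandermonde_ne_zero_iff.mpr hx)
  rcases Int.units_eq_one_or (Equiv.Perm.sign (Fin.revPerm : Equiv.Perm (Fin n))) with h | h <;>
    simp [h]

/-- `sepSolution` solves the quasi-separation relations where the `lam_i` are distinct. -/
theorem sepSolution_spec {n : ℕ} (m : ℕ) {x : PhaseSpace n} (hx : Function.Injective x.1)
    (i : Fin n) :
    ∑ j : Fin n, x.1 i ^ (n - 1 - (j : ℕ)) * sepSolution m x j = sepRhs m x i := by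
  have h : Matrix.mulVec (sepMatrix x) (sepSolution m x) = sepRhs m x := by
    rw [sepSolution, Matrix.mulVec_mulVec, Matrix.mul_nonsing_inv _ (sepMatrix_isUnit_det hx),
      Matrix.one_mulVec]
  exact congrFun h i

theorem contDiffOn_det {E : Type*} [NormedAddCommGroup E] [NormedSpace ℝ E] {n : ℕ} {s : Set E}
    {A : E → Matrix (Fin n) (Fin n) ℝ} (hA : ∀ i j, ContDiffOn ℝ ∞ (fun x => A x i j) s) :
    ContDiffOn ℝ ∞ (fun x => (A x).det) s := by
  simp only [Matrix.det_apply]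
  refine ContDiffOn.sum fun σ _ => ?_
  refine ContDiffOn.const_smul _ ?_
  exact contDiffOn_prod fun i _ => hA _ _

theorem contDiffOn_sepSolution {n : ℕ} (m : ℕ) {s : Set (PhaseSpace n)}
    (hs : ∀ x ∈ s, Function.Injective x.1) (j : Fin n) :
    ContDiffOn ℝ ∞ (fun x => sepSolution m x j) s := by
  have hl : ∀ i : Fin n, ContDiffOn ℝ ∞ (fun x : PhaseSpace n => x.1 i) s := fun i => by fun_prop
  have hm : ∀ i : Fin n, ContDiffOn ℝ ∞ (fun x : PhaseSpace n => x.2 i) s := fun i => by fun_prop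
  have hV : ∀ i j : Fin n, ContDiffOn ℝ ∞ (fun x : PhaseSpace n => sepMatrix x i j) s :=
    fun i j => (hl i).pow _
  have hne : ∀ i : Fin n, ∀ k ∈ Finset.univ.erase i, ∀ x ∈ s, x.1 i - x.1 k ≠ 0 :=
    fun i k hk x hx h => (Finset.ne_of_mem_erase hk) (hs x hx (sub_eq_zero.mp h)).symm
  have hR : ∀ i : Fin n, ContDiffOn ℝ ∞ (fun x => sepRhs m x i) s := by
    intro i
    refine ((contDiffOn_const.mul ((hl i).pow m)).mul ((hm i).pow 2)).add ?_
    unfold sepLinear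
    split_ifs
    · exact (ContDiffOn.sum fun k hk =>
        ((hm i).sub (hm k)).div ((hl i).sub (hl k)) (hne i k hk)).neg
    · exact (((hl i).pow _).neg.mul (ContDiffOn.sum fun k hk =>
        (((hl i).mul (hm i)).sub ((hl k).mul (hm k))).div ((hl i).sub (hl k)) (hne i k hk))).add
        ((contDiffOn_const.mul ((hl i).pow _)).mul (hm i))
    · exact (((hl i).pow _).neg.mul (ContDiffOn.sum fun k hk =>
        ((((hl i).pow 2).mul (hm i)).sub (((hl k).pow 2).mul (hm k))).div
          ((hl i).sub (hl k)) (hne i k hk))).add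
        ((contDiffOn_const.mul ((hl i).pow _)).mul (hm i))
  have hI : ∀ i : Fin n, ContDiffOn ℝ ∞ (fun x => (sepMatrix x)⁻¹ j i) s := by
    intro i
    simp only [Matrix.inv_def, Matrix.smul_apply, smul_eq_mul, Ring.inverse_eq_inv',
      Matrix.adjugate_apply]
    refine ((contDiffOn_det hV).inv fun x hx => (sepMatrix_isUnit_det (hs x hx)).ne_zero).mul ?_
    refine contDiffOn_det fun a b => ?_
    by_cases hab : a = i
    · simp only [Matrix.updateRow_apply, hab, if_true]
      exact contDiffOn_const
    · simp only [Matrix.updateRow_apply, hab, if_false]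
      exact hV a b
  simp only [sepSolution, Matrix.mulVec, dotProduct]
  exact ContDiffOn.sum fun i _ => (hI i).mul (hR i)

/-- The quasi-Stäckel Hamiltonians with parameter `m`, as smooth functions on an open set `U` on
which the coordinates `lam_i` are pairwise distinct; `qsHam m U hU i` is `h_{i+1}`. -/
def qsHam {n : ℕ} (m : ℕ) (U : TopologicalSpace.Opens (PhaseSpace n))
    (hU : ∀ x ∈ U, Function.Injective x.1) (i : Fin n) : SmoothFun U :=
  ⟨(U : Set (PhaseSpace n)).indicator fun x => sepSolution m x i,
    (contDiffOn_sepSolution m hU i).congr fun _ hx => Set.indicator_of_mem hx _,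
    fun _ hx => Set.indicator_of_notMem (by simpa using hx) _⟩

/-! ### Multi-time deformations of a Lie algebra -/

section Deformation

variable {n : ℕ} {L : Type*} [LieRing L] [LieAlgebra ℝ L]

/-- `L[t_1, …, t_n]`: polynomials in `n` times with values in `L`. It carries the bracket
`⁅p ⊗ x, q ⊗ y⁆ = (p q) ⊗ ⁅x, y⁆`. -/
abbrev TimePoly (n : ℕ) (L : Type*) [LieRing L] [LieAlgebra ℝ L] : Type _ :=
  MvPolynomial (Fin n) ℝ ⊗[ℝ] L

/-- `∂/∂t_j` on `L[t_1, …, t_n]`. -/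
def timeDeriv (j : Fin n) : TimePoly n L →ₗ[ℝ] TimePoly n L :=
  LinearMap.rTensor L (MvPolynomial.pderiv (R := ℝ) j).toLinearMap

/-- The value at `t = 0` of an element of `L[t_1, …, t_n]`. -/
def atZero : TimePoly n L →ₗ[ℝ] L :=
  (TensorProduct.lid ℝ L).toLinearMap ∘ₗ
    LinearMap.rTensor L (MvPolynomial.aeval (fun _ : Fin n => (0 : ℝ))).toLinearMap

/-- The subspace `L[t_j : j ∈ S]` of `L[t_1, …, t_n]`. -/
def timePolyIn (S : Set (Fin n)) : Submodule ℝ (TimePoly n L) :=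
  LinearMap.range (LinearMap.rTensor L (MvPolynomial.supported ℝ S).val.toLinearMap)

/-- The Frobenius (zero-curvature) condition
`∂H_i/∂t_j - ∂H_j/∂t_i + {H_i, H_j} = 0` for all `i, j`. -/
def FrobeniusCondition (H : Fin n → TimePoly n L) : Prop :=
  ∀ i j, timeDeriv j (H i) - timeDeriv i (H j) + ⁅H i, H j⁆ = 0

/-- The hypotheses of the deformation theorem on a basis `h_1, …, h_n` of `L`: the first
`dc ≥ 1` elements span the center, the first `da ≥ dc` elements span an Abelian subalgebra, and
`{h_i, h_j} ∈ span {h_1, …, h_{min(i,j)-1}}` for `i, j ≤ n - 1`. -/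
structure DeformationHypotheses (b : Module.Basis (Fin n) ℝ L) (dc da : ℕ) : Prop where
  one_le_dc : 1 ≤ dc
  dc_le_da : dc ≤ da
  da_le : da ≤ n
  center_eq : (LieAlgebra.center ℝ L).toSubmodule = Submodule.span ℝ (b '' {i | i.val < dc})
  abelian : ∃ A : LieSubalgebra ℝ L,
    A.toSubmodule = Submodule.span ℝ (b '' {i | i.val < da}) ∧ IsLieAbelian A
  triangular : ∀ i j : Fin n, i.val + 1 < n → j.val + 1 < n →
    ⁅b i, b j⁆ ∈ Submodule.span ℝ (b '' {k | k < i ∧ k < j})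

/-- `H_1, …, H_n` is a multi-time deformation of the basis `h_1, …, h_n` of `L`:
`H_i ∈ L[t_{dc+1}, …, t_{i-1}]`, the Frobenius condition holds, `H_i = h_i` for `i ≤ da`, and
`H_i = h_i` at `t = 0` for `i > da`. -/
structure IsMultiTimeDeformation (b : Module.Basis (Fin n) ℝ L) (dc da : ℕ)
    (H : Fin n → TimePoly n L) : Prop where
  mem : ∀ i, H i ∈ timePolyIn {j : Fin n | dc ≤ j.val ∧ j < i}
  frobenius : FrobeniusCondition H
  undeformed : ∀ i : Fin n, i.val < da → H i = 1 ⊗ₜ[ℝ] b i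
  initial : ∀ i : Fin n, da ≤ i.val → atZero (H i) = b i

/-- If `H` is a family with respect to the ordering `h'_i = h_{σ i}`, `t'_i = t_{σ i}`, this is
the same family with respect to the ordering `h_i`, `t_i`. -/
def toOriginalOrder (σ : Equiv.Perm (Fin n)) (H : Fin n → TimePoly n L) (i : Fin n) :
    TimePoly n L :=
  LinearMap.rTensor L (MvPolynomial.rename (R := ℝ) σ).toLinearMap (H (σ.symm i))

/-- `ad_{h_{r_k}} ⋯ ad_{h_{r_1}} h_i`, where `ad_f g = {g, f}`. -/
def nestedAd (h : Fin n → L) (i : Fin n) {k : ℕ} (r : Fin k → Fin n) : L :=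
  (List.ofFn r).foldl (fun x s => ⁅x, h s⁆) (h i)

/-- The sum, over `k ≤ N` and `i < r_1 ≤ ⋯ ≤ r_k`, of the terms
`(-1)^k α_{i r_1 … r_k} (ad_{h_{r_k}} ⋯ ad_{h_{r_1}} h_i) t_{r_1} ⋯ t_{r_k}`,
where the coefficient `α` is replaced by `1` for `k = 0` and `k = 1`. -/
def adExpansion (h : Fin n → L) (α : (k : ℕ) → Fin n → (Fin k → Fin n) → ℝ) (N : ℕ)
    (i : Fin n) : TimePoly n L := by
  classical exact
    ∑ k ∈ Finset.range (N + 1),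
      ∑ r ∈ (Finset.univ : Finset (Fin k → Fin n)).filter (fun r => Monotone r ∧ ∀ a, i < r a),
        ((-1 : ℝ) ^ k * (if k ≤ 1 then 1 else α k i r)) •
          ((∏ a, (MvPolynomial.X (r a) : MvPolynomial (Fin n) ℝ)) ⊗ₜ[ℝ] nestedAd h i r)

end Deformation

/-- The reordering `1 ↦ 1`, `i ↦ n - i + 2` for `i = 2, …, n`; with indices starting from `0`
it is `0 ↦ 0`, `i ↦ n - i`. -/
def reorder (n : ℕ) : Equiv.Perm (Fin n) :=
  Function.Involutive.toPerm
    (fun i => if h : i.val = 0 then i else ⟨n - i.val, by have := i.isLt; omega⟩) (by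
      intro i
      have hi := i.isLt
      by_cases h : i.val = 0
      · simp [h]
      · have h' : n - i.val ≠ 0 := by omega
        simp only [h, h', dif_neg, not_false_eq_true]
        exact Fin.ext (by simp only; omega))

/-- The dimension of the center of the algebra of quasi-Stäckel Hamiltonians for `m = n` and
`m = n + 1`. It is `1` and `2` respectively, except that for `(n, m) = (2, 2)` and
`(n, m) = (3, 4)` the whole algebra is commutative. -/
def centerDim (n m : ℕ) : ℕ :=
  if m = n then (if n = 2 then 2 else 1) else (if n = 3 then 3 else 2)

end

/-! Indices start at `0`, and `p = n - 2`, `ε = m - n`. Everything rests on the commutation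
relations `{h_a, h_b} = (b - a) h_{a+b+ε-1}` for `a, b ≥ 1`, with `h_0` central and terms of index
at least `n` dropped: a truncated Witt-type algebra (`lie_qsHam`).

Let `V` be the matrix of the linear system, so that `V h = F` with `F_i = qsRhs p ε i`. The bracket
`{F_i, F_k}` turns out to be a linear expression in `F_i` and `F_k`, with coefficients rational in
`λ_i`, `λ_k` (`bracket_qsRhs`). Differentiating `V h = F` expresses the entries of `V {h, h} Vᵀ`
through this bracket and correction terms from the derivatives of `V`, so these entries are linear
in `h`. Comparing the coefficients of each `h_q` leaves an identity in two variables
(`sum_qsConst`), and `V` is invertible. Linear independence follows from the part of `F` quadratic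
in the momenta. The center, the Abelian subalgebra and the triangularity are then read off from the
structure constants.

For the deformation, put `H_i = exp(t_{n-1} ad h_{n-1}) ⋯ exp(t_{i+1} ad h_{i+1}) h_i` with the
usual adjoint action, for `i ≥ 1`, and `H_0 = h_0`. For `r ≥ 2`, bracketing with `h_r` raises the
index, so `ad h_r` is nilpotent and the exponentials are polynomial Lie automorphisms.
Differentiating in `t_j` inserts `h_j`, which the outer exponentials carry to `H_j`; hence
`∂H_i/∂t_j = {H_j, H_i}` for `i < j` (`timeDeriv_flows`). As `H_j` does not involve `t_i`, this is
the Frobenius condition. Expanding the exponentials gives the formula with `α = 1 / ∏_j s_j!`, where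
`s_j` is the multiplicity of `j` among the `r_a` (`adExpansion_expCoeff`).

Uniqueness, of the family and of the constants alike, comes from
`FrobeniusCondition.eq_of_atZero_eq`: by descending induction on `i`, the difference of two
candidates for `H_i` solves a linear homogeneous system with zero initial value. -/

noncomputable section

/-! ### Right-hand sides of the separation relations and their derivatives -/

/-- The right-hand side of the quasi-separation relations, with the exponents decoupled from the
number of degrees of freedom. -/
def qsRhs {N : ℕ} (p ε : ℕ) (i : Fin N) (x : PhaseSpace N) : ℝ :=
  (1 / 2) * x.1 i ^ (p + 2 + ε) * x.2 i ^ 2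
    - x.1 i ^ (p + 1) * ∑ k ∈ Finset.univ.erase i,
      (x.1 i ^ (ε + 1) * x.2 i - x.1 k ^ (ε + 1) * x.2 k) / (x.1 i - x.1 k)
    + ((p : ℝ) + 1) * x.1 i ^ (p + 1 + ε) * x.2 i

theorem sepRhs_eq_qsRhs (p ε : ℕ) (hε : ε = 0 ∨ ε = 1) (x : PhaseSpace (p + 2))
    (i : Fin (p + 2)) : sepRhs (p + 2 + ε) x i = qsRhs p ε i x := by
  rcases hε with rfl | rfl
  · simp [sepRhs, sepLinear, qsRhs]
    ring
  · simp [sepRhs, sepLinear, qsRhs]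
    ring

theorem hasLineDerivAt_qsRhs {N : ℕ} (p ε : ℕ) (i : Fin N) {x : PhaseSpace N}
    (hx : Function.Injective x.1) (v : PhaseSpace N) :
    HasLineDerivAt ℝ (qsRhs p ε i)
      ((1 / 2) * (((p + 2 + ε : ℝ) * x.1 i ^ (p + 1 + ε) * v.1 i) * x.2 i ^ 2
          + x.1 i ^ (p + 2 + ε) * (2 * x.2 i * v.2 i))
        - ((p + 1 : ℝ) * x.1 i ^ p * v.1 i * ∑ k ∈ Finset.univ.erase i,
            (x.1 i ^ (ε + 1) * x.2 i - x.1 k ^ (ε + 1) * x.2 k) / (x.1 i - x.1 k)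
          + x.1 i ^ (p + 1) * ∑ k ∈ Finset.univ.erase i,
            ((((ε + 1 : ℝ) * x.1 i ^ ε * v.1 i * x.2 i + x.1 i ^ (ε + 1) * v.2 i)
              - ((ε + 1 : ℝ) * x.1 k ^ ε * v.1 k * x.2 k + x.1 k ^ (ε + 1) * v.2 k))
                / (x.1 i - x.1 k)
              - (x.1 i ^ (ε + 1) * x.2 i - x.1 k ^ (ε + 1) * x.2 k) * (v.1 i - v.1 k)
                / (x.1 i - x.1 k) ^ 2))
        + (p + 1 : ℝ) * ((p + 1 + ε : ℝ) * x.1 i ^ (p + ε) * v.1 i * x.2 i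
          + x.1 i ^ (p + 1 + ε) * v.2 i)) x v := by
  unfold HasLineDerivAt qsRhs
  have hl : ∀ k, HasDerivAt (fun t : ℝ => (x + t • v).1 k) (v.1 k) 0 := fun k => by
    simpa using ((hasDerivAt_id (0 : ℝ)).mul_const (v.1 k)).const_add (x.1 k)
  have hm : ∀ k, HasDerivAt (fun t : ℝ => (x + t • v).2 k) (v.2 k) 0 := fun k => by
    simpa using ((hasDerivAt_id (0 : ℝ)).mul_const (v.2 k)).const_add (x.2 k)
  have e1 : ∀ k, (x + (0 : ℝ) • v).1 k = x.1 k := fun k => by simp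
  have e2 : ∀ k, (x + (0 : ℝ) • v).2 k = x.2 k := fun k => by simp
  have hq : ∀ k ∈ Finset.univ.erase i, HasDerivAt (fun t : ℝ =>
      ((x + t • v).1 i ^ (ε + 1) * (x + t • v).2 i - (x + t • v).1 k ^ (ε + 1) * (x + t • v).2 k)
        / ((x + t • v).1 i - (x + t • v).1 k)) _ 0 := fun k hk =>
    (((((hl i).fun_pow (ε + 1)).fun_mul (hm i)).fun_sub
      (((hl k).fun_pow (ε + 1)).fun_mul (hm k))).fun_div
      ((hl i).fun_sub (hl k)) (by
        simp only [e1]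
        exact fun h => Finset.ne_of_mem_erase hk (hx (sub_eq_zero.mp h)).symm))
  have key := ((((((hl i).fun_pow (p + 2 + ε)).const_mul (1 / 2)).fun_mul ((hm i).fun_pow 2)).fun_sub
    (((hl i).fun_pow (p + 1)).fun_mul (HasDerivAt.fun_sum hq))).fun_add
    ((((hl i).fun_pow (p + 1 + ε)).const_mul ((p : ℝ) + 1)).fun_mul (hm i)))
  convert key using 1
  simp only [e1, e2]
  have : ∀ k ∈ Finset.univ.erase i, x.1 i - x.1 k ≠ 0 :=
    fun k hk h => Finset.ne_of_mem_erase hk (hx (sub_eq_zero.mp h)).symm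
  have hp : p + 2 + ε - 1 = p + 1 + ε := by omega
  have hp' : p + 1 + ε - 1 = p + ε := by omega
  have hsum : ∀ k ∈ Finset.univ.erase i, _ := fun k hk => by
    have h0 := this k hk
    have hh : ((((ε + 1 : ℝ) * x.1 i ^ ε * v.1 i * x.2 i + x.1 i ^ (ε + 1) * v.2 i)
              - ((ε + 1 : ℝ) * x.1 k ^ ε * v.1 k * x.2 k + x.1 k ^ (ε + 1) * v.2 k))
                / (x.1 i - x.1 k)
              - (x.1 i ^ (ε + 1) * x.2 i - x.1 k ^ (ε + 1) * x.2 k) * (v.1 i - v.1 k)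
                / (x.1 i - x.1 k) ^ 2) =
      ((((ε + 1 : ℝ) * x.1 i ^ ε * v.1 i * x.2 i + x.1 i ^ (ε + 1) * v.2 i)
              - ((ε + 1 : ℝ) * x.1 k ^ ε * v.1 k * x.2 k + x.1 k ^ (ε + 1) * v.2 k))
                * (x.1 i - x.1 k)
              - (x.1 i ^ (ε + 1) * x.2 i - x.1 k ^ (ε + 1) * x.2 k) * (v.1 i - v.1 k))
                / (x.1 i - x.1 k) ^ 2 := by
      field_simp
    exact hh
  rw [Finset.sum_congr rfl hsum]
  simp only [hp, hp', Nat.add_sub_cancel]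
  push_cast
  ring

theorem differentiableAt_qsRhs {N : ℕ} (p ε : ℕ) (i : Fin N) {x : PhaseSpace N}
    (hx : Function.Injective x.1) : DifferentiableAt ℝ (qsRhs p ε i) x := by
  have hl : ∀ k, DifferentiableAt ℝ (fun y : PhaseSpace N => y.1 k) x := fun k => by fun_prop
  have hm : ∀ k, DifferentiableAt ℝ (fun y : PhaseSpace N => y.2 k) x := fun k => by fun_prop
  unfold qsRhs
  refine ((((hl i).fun_pow _).const_mul _).fun_mul ((hm i).fun_pow 2)).fun_sub
    (((hl i).fun_pow _).fun_mul (DifferentiableAt.fun_sum fun k hk => ?_)) |>.fun_add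
      ((((hl i).fun_pow _).const_mul _).fun_mul (hm i))
  have hne : x.1 i - x.1 k ≠ 0 :=
    fun h => Finset.ne_of_mem_erase hk (hx (sub_eq_zero.mp h)).symm
  have h1 : DifferentiableAt ℝ (fun y : PhaseSpace N =>
      y.1 i ^ (ε + 1) * y.2 i - y.1 k ^ (ε + 1) * y.2 k) x :=
    (((hl i).fun_pow _).fun_mul (hm i)).fun_sub (((hl k).fun_pow _).fun_mul (hm k))
  have h2 : DifferentiableAt ℝ (fun y : PhaseSpace N => (y.1 i - y.1 k)⁻¹) x :=
    ((hl i).fun_sub (hl k)).fun_inv hne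
  simpa only [div_eq_mul_inv] using h1.fun_mul h2

theorem fderiv_qsRhs {N : ℕ} (p ε : ℕ) (i : Fin N) {x : PhaseSpace N}
    (hx : Function.Injective x.1) (v : PhaseSpace N) {d : ℝ}
    (hd : HasLineDerivAt ℝ (qsRhs p ε i) d x v) : fderiv ℝ (qsRhs p ε i) x v = d :=
  (differentiableAt_qsRhs p ε i hx).lineDeriv_eq_fderiv.symm.trans hd.lineDeriv

theorem dMu_qsRhs_self {N : ℕ} (p ε : ℕ) (i : Fin N) {x : PhaseSpace N}
    (hx : Function.Injective x.1) :
    dMu i (qsRhs p ε i) x = x.1 i ^ (p + 2 + ε) * x.2 i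
      - x.1 i ^ (p + 1) * ∑ k ∈ Finset.univ.erase i, x.1 i ^ (ε + 1) / (x.1 i - x.1 k)
      + (p + 1 : ℝ) * x.1 i ^ (p + 1 + ε) := by
  rw [dMu, fderiv_qsRhs p ε i hx _ (hasLineDerivAt_qsRhs p ε i hx _)]
  have : ∀ k ∈ Finset.univ.erase i, _ := fun k hk =>
    Pi.single_eq_of_ne (M := fun _ => ℝ) (Finset.ne_of_mem_erase hk) 1
  rw [Finset.sum_congr rfl (s₁ := Finset.univ.erase i)
    (g := fun k => x.1 i ^ (ε + 1) / (x.1 i - x.1 k))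
    (f := fun k => (((ε + 1 : ℝ) * x.1 i ^ ε * (0 : Fin N → ℝ) i * x.2 i
      + x.1 i ^ (ε + 1) * (Pi.single i 1 : Fin N → ℝ) i)
              - ((ε + 1 : ℝ) * x.1 k ^ ε * (0 : Fin N → ℝ) k * x.2 k
                + x.1 k ^ (ε + 1) * (Pi.single i 1 : Fin N → ℝ) k))
                / (x.1 i - x.1 k)
              - (x.1 i ^ (ε + 1) * x.2 i - x.1 k ^ (ε + 1) * x.2 k)
                * ((0 : Fin N → ℝ) i - (0 : Fin N → ℝ) k)
                / (x.1 i - x.1 k) ^ 2) fun k hk => by simp [this k hk]]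
  simp
  ring

theorem dMu_qsRhs_of_ne {N : ℕ} (p ε : ℕ) {i l : Fin N} (hl : l ≠ i) {x : PhaseSpace N}
    (hx : Function.Injective x.1) :
    dMu l (qsRhs p ε i) x = x.1 i ^ (p + 1) * x.1 l ^ (ε + 1) / (x.1 i - x.1 l) := by
  rw [dMu, fderiv_qsRhs p ε i hx _ (hasLineDerivAt_qsRhs p ε i hx _)]
  rw [Finset.sum_eq_single_of_mem (s := Finset.univ.erase i) l (by simp [hl])
    (f := fun k => (((ε + 1 : ℝ) * x.1 i ^ ε * (0 : Fin N → ℝ) i * x.2 i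
      + x.1 i ^ (ε + 1) * (Pi.single l 1 : Fin N → ℝ) i)
              - ((ε + 1 : ℝ) * x.1 k ^ ε * (0 : Fin N → ℝ) k * x.2 k
                + x.1 k ^ (ε + 1) * (Pi.single l 1 : Fin N → ℝ) k))
                / (x.1 i - x.1 k)
              - (x.1 i ^ (ε + 1) * x.2 i - x.1 k ^ (ε + 1) * x.2 k)
                * ((0 : Fin N → ℝ) i - (0 : Fin N → ℝ) k)
                / (x.1 i - x.1 k) ^ 2)
    fun k _ hkl => by simp [hkl, hl.symm]]
  simp [hl.symm]
  ring

theorem dLam_qsRhs_self {N : ℕ} (p ε : ℕ) (i : Fin N) {x : PhaseSpace N}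
    (hx : Function.Injective x.1) :
    dLam i (qsRhs p ε i) x = (1 / 2) * (p + 2 + ε : ℝ) * x.1 i ^ (p + 1 + ε) * x.2 i ^ 2
      - ((p + 1 : ℝ) * x.1 i ^ p * ∑ k ∈ Finset.univ.erase i,
            (x.1 i ^ (ε + 1) * x.2 i - x.1 k ^ (ε + 1) * x.2 k) / (x.1 i - x.1 k)
        + x.1 i ^ (p + 1) * ∑ k ∈ Finset.univ.erase i,
          ((ε + 1 : ℝ) * x.1 i ^ ε * x.2 i / (x.1 i - x.1 k)
            - (x.1 i ^ (ε + 1) * x.2 i - x.1 k ^ (ε + 1) * x.2 k) / (x.1 i - x.1 k) ^ 2))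
      + (p + 1 : ℝ) * (p + 1 + ε : ℝ) * x.1 i ^ (p + ε) * x.2 i := by
  rw [dLam, fderiv_qsRhs p ε i hx _ (hasLineDerivAt_qsRhs p ε i hx _)]
  have : ∀ k ∈ Finset.univ.erase i, _ := fun k hk =>
    Pi.single_eq_of_ne (M := fun _ => ℝ) (Finset.ne_of_mem_erase hk) 1
  rw [Finset.sum_congr rfl (s₁ := Finset.univ.erase i)
    (g := fun k => (ε + 1 : ℝ) * x.1 i ^ ε * x.2 i / (x.1 i - x.1 k)
            - (x.1 i ^ (ε + 1) * x.2 i - x.1 k ^ (ε + 1) * x.2 k) / (x.1 i - x.1 k) ^ 2)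
    (f := fun k => (((ε + 1 : ℝ) * x.1 i ^ ε * (Pi.single i 1 : Fin N → ℝ) i * x.2 i
      + x.1 i ^ (ε + 1) * (0 : Fin N → ℝ) i)
              - ((ε + 1 : ℝ) * x.1 k ^ ε * (Pi.single i 1 : Fin N → ℝ) k * x.2 k
                + x.1 k ^ (ε + 1) * (0 : Fin N → ℝ) k))
                / (x.1 i - x.1 k)
              - (x.1 i ^ (ε + 1) * x.2 i - x.1 k ^ (ε + 1) * x.2 k)
                * ((Pi.single i 1 : Fin N → ℝ) i - (Pi.single i 1 : Fin N → ℝ) k)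
                / (x.1 i - x.1 k) ^ 2) fun k hk => by simp [this k hk]]
  simp
  ring

theorem dLam_qsRhs_of_ne {N : ℕ} (p ε : ℕ) {i l : Fin N} (hl : l ≠ i) {x : PhaseSpace N}
    (hx : Function.Injective x.1) :
    dLam l (qsRhs p ε i) x = x.1 i ^ (p + 1) * ((ε + 1 : ℝ) * x.1 l ^ ε * x.2 l / (x.1 i - x.1 l)
      - (x.1 i ^ (ε + 1) * x.2 i - x.1 l ^ (ε + 1) * x.2 l) / (x.1 i - x.1 l) ^ 2) := by
  rw [dLam, fderiv_qsRhs p ε i hx _ (hasLineDerivAt_qsRhs p ε i hx _)]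
  rw [Finset.sum_eq_single_of_mem (s := Finset.univ.erase i) l (by simp [hl])
    (f := fun k => (((ε + 1 : ℝ) * x.1 i ^ ε * (Pi.single l 1 : Fin N → ℝ) i * x.2 i
      + x.1 i ^ (ε + 1) * (0 : Fin N → ℝ) i)
              - ((ε + 1 : ℝ) * x.1 k ^ ε * (Pi.single l 1 : Fin N → ℝ) k * x.2 k
                + x.1 k ^ (ε + 1) * (0 : Fin N → ℝ) k))
                / (x.1 i - x.1 k)
              - (x.1 i ^ (ε + 1) * x.2 i - x.1 k ^ (ε + 1) * x.2 k)
                * ((Pi.single l 1 : Fin N → ℝ) i - (Pi.single l 1 : Fin N → ℝ) k)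
                / (x.1 i - x.1 k) ^ 2)
    fun k _ hkl => by simp [hkl, hl.symm]]
  simp [hl.symm]
  ring

/-! ### Poisson brackets of the right-hand sides -/

/-- The value of the bracket of two separation relations with right-hand sides `F`, `G` at the
points `z`, `y`. -/
def sepBracket (p ε : ℕ) (z y F G : ℝ) : ℝ :=
  -(p + 1 - ε : ℝ) * (z ^ (p + 1) * y ^ ε * G + y ^ (p + 1) * z ^ ε * F) / (y - z)
    + (y + z) * (y ^ (p + 1) * z ^ ε * F - z ^ (p + 1) * y ^ ε * G) / (y - z) ^ 2

/-- This is a three-point identity. The canonical pair at a third point `x` contributes to the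
bracket exactly what cancels the `x`-summands in the contributions of the pairs at `z` and `y`, up
to the `sepBracket` of the `x`-summands of the two right-hand sides. It makes the summation over
third points harmless. -/
theorem bracket_summand_eq (p ε : ℕ) (hε : ε = 0 ∨ ε = 1) {z y x : ℝ} (a b c : ℝ) (hzy : z ≠ y)
    (hzx : z ≠ x) (hyx : y ≠ x) :
    z ^ (p + 1) * x ^ (ε + 1) / (z - x)
        * (y ^ (p + 1) * ((ε + 1 : ℝ) * x ^ ε * c / (y - x)
          - (y ^ (ε + 1) * b - x ^ (ε + 1) * c) / (y - x) ^ 2))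
      - z ^ (p + 1) * ((ε + 1 : ℝ) * x ^ ε * c / (z - x)
          - (z ^ (ε + 1) * a - x ^ (ε + 1) * c) / (z - x) ^ 2)
        * (y ^ (p + 1) * x ^ (ε + 1) / (y - x))
    = z ^ (p + 1) * (z ^ (ε + 1) / (z - x))
        * (y ^ (p + 1) * ((ε + 1 : ℝ) * z ^ ε * a / (y - z)
          - (y ^ (ε + 1) * b - z ^ (ε + 1) * a) / (y - z) ^ 2))
      - ((p + 1 : ℝ) * z ^ p * ((z ^ (ε + 1) * a - x ^ (ε + 1) * c) / (z - x))
          + z ^ (p + 1) * ((ε + 1 : ℝ) * z ^ ε * a / (z - x)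
            - (z ^ (ε + 1) * a - x ^ (ε + 1) * c) / (z - x) ^ 2))
        * (y ^ (p + 1) * z ^ (ε + 1) / (y - z))
      - y ^ (p + 1) * (y ^ (ε + 1) / (y - x))
        * (z ^ (p + 1) * ((ε + 1 : ℝ) * y ^ ε * b / (z - y)
          - (z ^ (ε + 1) * a - y ^ (ε + 1) * b) / (z - y) ^ 2))
      + ((p + 1 : ℝ) * y ^ p * ((y ^ (ε + 1) * b - x ^ (ε + 1) * c) / (y - x))
          + y ^ (p + 1) * ((ε + 1 : ℝ) * y ^ ε * b / (y - x)
            - (y ^ (ε + 1) * b - x ^ (ε + 1) * c) / (y - x) ^ 2))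
        * (z ^ (p + 1) * y ^ (ε + 1) / (z - y))
      + sepBracket p ε z y (-z ^ (p + 1) * ((z ^ (ε + 1) * a - x ^ (ε + 1) * c) / (z - x)))
          (-y ^ (p + 1) * ((y ^ (ε + 1) * b - x ^ (ε + 1) * c) / (y - x))) := by
  have h1 := sub_ne_zero.mpr hzy
  have h2 := sub_ne_zero.mpr hzx
  have h3 := sub_ne_zero.mpr hyx
  have h4 : y - z = -(z - y) := by ring
  rcases hε with rfl | rfl
  · simp only [sepBracket, h4, pow_succ, pow_zero, one_mul, Nat.cast_zero]
    field_simp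
    ring
  · simp only [sepBracket, h4, pow_succ, pow_zero, one_mul, Nat.cast_one]
    field_simp
    ring

theorem sepBracket_add (p ε : ℕ) (z y F G F' G' : ℝ) :
    sepBracket p ε z y (F + F') (G + G') = sepBracket p ε z y F G + sepBracket p ε z y F' G' := by
  simp only [sepBracket]
  ring

/-- Linearity of `sepBracket` in the pair `(F, G)` serves twice: for sums over third points, and
later for splitting `F = V h` into its components along each `h_q`. -/
theorem sepBracket_sum {ι : Type*} (p ε : ℕ) (z y : ℝ) (s : Finset ι) (F G : ι → ℝ) :
    ∑ l ∈ s, sepBracket p ε z y (F l) (G l)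
      = sepBracket p ε z y (∑ l ∈ s, F l) (∑ l ∈ s, G l) := by
  classical
  induction s using Finset.induction_on with
  | empty => simp [sepBracket]
  | insert a s ha ih => rw [Finset.sum_insert ha, Finset.sum_insert ha, Finset.sum_insert ha,
      sepBracket_add, ih]

theorem bracket_qsRhs {N : ℕ} (p ε : ℕ) (hε : ε = 0 ∨ ε = 1) {i k : Fin N} (hik : i ≠ k)
    {x : PhaseSpace N} (hx : Function.Injective x.1) :
    ∑ l, (dMu l (qsRhs p ε i) x * dLam l (qsRhs p ε k) x
        - dLam l (qsRhs p ε i) x * dMu l (qsRhs p ε k) x)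
      = sepBracket p ε (x.1 i) (x.1 k) (qsRhs p ε i x) (qsRhs p ε k x) := by
  have hki : k ≠ i := hik.symm
  -- `s` is the set of third points; each sum is split into its terms at `i`, `k` and a sum over
  -- `s`.
  set s := (Finset.univ.erase i).erase k with hs
  have hs' : s = (Finset.univ.erase k).erase i := Finset.erase_right_comm
  have e1 : ∀ f : Fin N → ℝ, ∑ l ∈ Finset.univ.erase i, f l = f k + ∑ l ∈ s, f l := fun f =>
    (Finset.add_sum_erase _ f (by simp [hki])).symm
  have e2 : ∀ f : Fin N → ℝ, ∑ l ∈ Finset.univ.erase k, f l = f i + ∑ l ∈ s, f l := fun f => by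
    rw [hs']
    exact (Finset.add_sum_erase _ f (by simp [hik])).symm
  have e3 : ∀ f : Fin N → ℝ, ∑ l, f l = f i + (f k + ∑ l ∈ s, f l) := fun f => by
    rw [← e1, Finset.add_sum_erase _ f (Finset.mem_univ i)]
  have hsi : ∀ l ∈ s, l ≠ i := fun l hl => Finset.ne_of_mem_erase (Finset.mem_of_mem_erase hl)
  have hsk : ∀ l ∈ s, l ≠ k := fun l hl => Finset.ne_of_mem_erase hl
  have hne : ∀ {a b : Fin N}, a ≠ b → x.1 a ≠ x.1 b := fun h h' => h (hx h')
  rw [e3, Finset.sum_congr rfl fun l hl => by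
    rw [dMu_qsRhs_of_ne p ε (hsi l hl) hx, dMu_qsRhs_of_ne p ε (hsk l hl) hx,
      dLam_qsRhs_of_ne p ε (hsi l hl) hx, dLam_qsRhs_of_ne p ε (hsk l hl) hx,
      bracket_summand_eq p ε hε (x.2 i) (x.2 k) (x.2 l) (hne hik) (hne (hsi l hl).symm)
        (hne (hsk l hl).symm)]]
  rw [Finset.sum_add_distrib, Finset.sum_add_distrib, Finset.sum_sub_distrib,
    Finset.sum_sub_distrib, sepBracket_sum]
  simp only [← Finset.mul_sum, ← Finset.sum_mul, Finset.sum_add_distrib]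
  rw [dMu_qsRhs_self p ε i hx, dMu_qsRhs_self p ε k hx, dLam_qsRhs_self p ε i hx,
    dLam_qsRhs_self p ε k hx, dMu_qsRhs_of_ne p ε hik hx, dMu_qsRhs_of_ne p ε hki hx,
    dLam_qsRhs_of_ne p ε hik hx, dLam_qsRhs_of_ne p ε hki hx]
  simp only [qsRhs, e1, e2]
  have h1 := sub_ne_zero.mpr (hne hik)
  have h2 := sub_ne_zero.mpr (hne hki)
  -- The sums over third points may now be treated as free symbols: what remains is a rational
  -- identity in the two pairs of coordinates.
  generalize (∑ l ∈ s, x.1 i ^ (ε + 1) / (x.1 i - x.1 l)) = S₁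
  generalize (∑ l ∈ s, x.1 k ^ (ε + 1) / (x.1 k - x.1 l)) = S₂
  generalize (∑ l ∈ s, (x.1 i ^ (ε + 1) * x.2 i - x.1 l ^ (ε + 1) * x.2 l)
    / (x.1 i - x.1 l)) = S₃
  generalize (∑ l ∈ s, (x.1 k ^ (ε + 1) * x.2 k - x.1 l ^ (ε + 1) * x.2 l)
    / (x.1 k - x.1 l)) = S₄
  generalize (∑ l ∈ s, ((ε + 1 : ℝ) * x.1 i ^ ε * x.2 i / (x.1 i - x.1 l)
    - (x.1 i ^ (ε + 1) * x.2 i - x.1 l ^ (ε + 1) * x.2 l) / (x.1 i - x.1 l) ^ 2)) = S₅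
  generalize (∑ l ∈ s, ((ε + 1 : ℝ) * x.1 k ^ ε * x.2 k / (x.1 k - x.1 l)
    - (x.1 k ^ (ε + 1) * x.2 k - x.1 l ^ (ε + 1) * x.2 l) / (x.1 k - x.1 l) ^ 2)) = S₆
  clear e1 e2 e3 hsi hsk hs' hs hne
  generalize x.1 i = z at *
  generalize x.1 k = y at *
  generalize x.2 i = a
  generalize x.2 k = b
  have h4 : y - z = -(z - y) := by ring
  rcases hε with rfl | rfl
  · simp only [sepBracket, h4, pow_succ, pow_zero, one_mul, Nat.cast_zero, add_zero]
    field_simp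
    ring
  · simp only [sepBracket, h4, pow_succ, pow_zero, one_mul, Nat.cast_one]
    field_simp
    ring

/-! ### Generating identities for the structure constants -/

/-- The sum is `y ∂_y - z ∂_z` applied to the geometric sum `(z^(M+1) - y^(M+1)) / (z - y)`, which
explains the closed form; the proof is an induction on `M`. -/
theorem geomSum_sub_mul (M : ℕ) (z y : ℝ) :
    (z - y) ^ 2 * ∑ A ∈ Finset.range (M + 1), ((M : ℝ) - 2 * A) * (z ^ A * y ^ (M - A))
      = (z + y) * (z ^ (M + 1) - y ^ (M + 1)) - (M + 1) * (z - y) * (z ^ (M + 1) + y ^ (M + 1)) := by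
  have h1 : ∀ M : ℕ, (z - y) * ∑ A ∈ Finset.range (M + 1), z ^ A * y ^ (M - A)
      = z ^ (M + 1) - y ^ (M + 1) := fun M => by
    have := mul_comm (z - y) _ ▸ geom_sum₂_mul z y (M + 1)
    rw [← this]
    simp
  induction M with
  | zero => simp; ring
  | succ M ih =>
    rw [Finset.sum_range_succ]
    have : ∀ A ∈ Finset.range (M + 1), ((M + 1 : ℕ) - 2 * A : ℝ) * (z ^ A * y ^ (M + 1 - A))
        = y * (((M : ℝ) - 2 * A) * (z ^ A * y ^ (M - A))) + y * (z ^ A * y ^ (M - A)) := by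
      intro A hA
      rw [Nat.succ_sub (by simpa [Nat.lt_succ_iff] using hA), pow_succ]
      push_cast
      ring
    rw [Finset.sum_congr rfl this, Finset.sum_add_distrib, ← Finset.mul_sum, ← Finset.mul_sum,
      mul_add, mul_add]
    have e := h1 M
    simp only [Nat.sub_self, pow_zero, mul_one]
    push_cast
    linear_combination y * ih + (z - y) * y * e

/-- The structure constants of the algebra of quasi-Stäckel Hamiltonians. -/
def qsConst (ε a b q : ℕ) : ℝ :=
  if 1 ≤ a ∧ 1 ≤ b ∧ a + b + ε = q + 1 then (b : ℝ) - a else 0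

theorem qsConst_swap (ε a b q : ℕ) : qsConst ε b a q = -qsConst ε a b q := by
  unfold qsConst
  by_cases h : 1 ≤ a ∧ 1 ≤ b ∧ a + b + ε = q + 1
  · rw [if_pos h, if_pos ⟨h.2.1, h.1, by omega⟩]
    ring
  · rw [if_neg h, if_neg (fun h' => h ⟨h'.2.1, h'.1, by omega⟩), neg_zero]

/-- For fixed `q` only the antidiagonal `a + b + ε = q + 1` survives; it is parametrised by `b = A +
1`, `a = q - ε - A`. -/
theorem sum_qsConst_eq_sum_range (p ε q : ℕ) (hq : q ≤ p + 1) (z y : ℝ) :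
    ∑ b ∈ Finset.range (p + 2), ∑ a ∈ Finset.range (p + 2),
        z ^ (p + 1 - a) * y ^ (p + 1 - b) * qsConst ε a b q
      = ∑ A ∈ Finset.range (q - ε),
        z ^ (p + 1 - (q - ε - A)) * y ^ (p - A) * (2 * A + 1 - (q - ε : ℕ)) := by
  have h0 : ∑ a ∈ Finset.range (p + 2), z ^ (p + 1 - a) * y ^ (p + 1 - 0) * qsConst ε a 0 q = 0 :=
    Finset.sum_eq_zero fun a _ => by simp [qsConst]
  rw [Finset.sum_range_succ', h0, add_zero]
  have h1 : ∀ A ∈ Finset.range (p + 1), ∑ a ∈ Finset.range (p + 2),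
      z ^ (p + 1 - a) * y ^ (p + 1 - (A + 1)) * qsConst ε a (A + 1) q
      = if A < q - ε then
          z ^ (p + 1 - (q - ε - A)) * y ^ (p - A) * (2 * A + 1 - (q - ε : ℕ)) else 0 := by
    intro A hA
    split_ifs with h
    · rw [Finset.sum_eq_single_of_mem (q - ε - A) (by simp; omega)]
      · rw [qsConst, if_pos (by omega), Nat.add_sub_add_right, Nat.cast_sub h.le]
        push_cast
        ring
      · intro a _ ha
        rw [qsConst, if_neg (by omega), mul_zero]
    · refine Finset.sum_eq_zero fun a _ => ?_
      rw [qsConst, if_neg (by omega), mul_zero]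
  rw [Finset.sum_congr rfl h1, ← Finset.sum_filter]
  refine Finset.sum_congr ?_ fun _ _ => rfl
  ext A
  simp
  omega

/-- This is the coefficient of `h_q` in the commutation relations after multiplication by `V` and
`Vᵀ`: `sepBracket` of the monomials multiplying `h_q`, corrected by the derivatives of those
monomials. -/
theorem sum_qsConst (p ε q : ℕ) (hε : ε = 0 ∨ ε = 1) (hq : q ≤ p + 1) {z y : ℝ} (hzy : z ≠ y) :
    ∑ b ∈ Finset.range (p + 2), ∑ a ∈ Finset.range (p + 2),
        z ^ (p + 1 - a) * y ^ (p + 1 - b) * qsConst ε a b q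
      = sepBracket p ε z y (z ^ (p + 1 - q)) (y ^ (p + 1 - q))
        - (((p + 1 - q : ℕ) : ℝ) * y ^ (p + 1 - q - 1)) * (z ^ (p + 1) * y ^ (ε + 1) / (z - y))
        + (((p + 1 - q : ℕ) : ℝ) * z ^ (p + 1 - q - 1))
          * (y ^ (p + 1) * z ^ (ε + 1) / (y - z)) := by
  rw [sum_qsConst_eq_sum_range p ε q hq]
  obtain ⟨r, hr⟩ : ∃ r, p + 1 = q + r := ⟨p + 1 - q, by omega⟩
  have hr' : p + 1 - q = r := by omega
  -- The extra factor `t` removes the truncated exponent `r - 1`, so that `r = 0` needs no separate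
  -- treatment below.
  have hpow : ∀ t : ℝ, (r : ℝ) * t ^ (r - 1) * t = r * t ^ r := fun t => by
    rcases r with _ | r
    · simp
    · simp [pow_succ, mul_assoc]
  have h1 := sub_ne_zero.mpr hzy
  have h4 : y - z = -(z - y) := by ring
  rw [hr']
  have hz := hpow z
  have hy := hpow y
  generalize (r : ℝ) * z ^ (r - 1) = Z at *
  generalize (r : ℝ) * y ^ (r - 1) = Y at *
  have hp : (p : ℝ) + 1 = q + r := by exact_mod_cast hr
  rw [sepBracket, hr]
  -- For `q ≤ ε` the antidiagonal is empty, as no bracket produces `h_q`; otherwise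
  -- `geomSum_sub_mul` applies with `M = q - ε - 1`.
  by_cases hqe : q ≤ ε
  · rw [Nat.sub_eq_zero_of_le hqe, Finset.range_zero, Finset.sum_empty]
    rcases hε with rfl | rfl
    · obtain rfl : q = 0 := by omega
      rw [hp, h4]
      simp only [zero_add, pow_zero, mul_one, pow_one, Nat.cast_zero]
      field_simp
      linear_combination (y ^ r * (z - y)) * hz + (z ^ r * (z - y)) * hy
    · rw [hp, h4]
      rcases (by omega : q = 0 ∨ q = 1) with rfl | rfl
      · simp only [zero_add, Nat.cast_zero, Nat.cast_one, pow_succ, pow_zero, one_mul]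
        field_simp
        linear_combination (y ^ r * z) * hz + (z ^ r * y) * hy
      · simp only [Nat.cast_one, pow_succ, pow_zero, one_mul, pow_add]
        field_simp
        linear_combination (y * y ^ r * (z - y) * z) * hz + (z * z ^ r * (z - y) * y) * hy
  · obtain ⟨M, rfl⟩ : ∃ M, q = ε + (M + 1) := ⟨q - ε - 1, by omega⟩
    have hs : ∀ A ∈ Finset.range (M + 1),
        z ^ (ε + (M + 1) + r - (M + 1 - A)) * y ^ (p - A) * (2 * A + 1 - (M + 1 : ℕ))
          = -((z * y) ^ (r + ε) * (((M : ℝ) - 2 * A) * (z ^ A * y ^ (M - A)))) := by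
      intro A hA
      rw [Finset.mem_range] at hA
      rw [show ε + (M + 1) + r - (M + 1 - A) = r + ε + A by omega,
        show p - A = r + ε + (M - A) by omega, pow_add, pow_add, mul_pow]
      push_cast
      ring
    rw [Nat.add_sub_cancel_left, Finset.sum_congr rfl hs, Finset.sum_neg_distrib, ← Finset.mul_sum]
    have g := geomSum_sub_mul M z y
    have g' : ∑ A ∈ Finset.range (M + 1), ((M : ℝ) - 2 * A) * (z ^ A * y ^ (M - A))
        = ((z + y) * (z ^ (M + 1) - y ^ (M + 1))
          - (M + 1) * (z - y) * (z ^ (M + 1) + y ^ (M + 1))) / (z - y) ^ 2 := by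
      rw [← g]
      field_simp
    rw [g', hp, h4]
    push_cast
    simp only [pow_add, pow_one, mul_pow]
    field_simp
    linear_combination ((y ^ ε * y ^ M * y * y ^ r) * (z - y) * z ^ ε) * hz
      + ((z ^ ε * z ^ M * z * z ^ r) * (z - y) * y ^ ε) * hy

/-! ### Commutation relations of the Hamiltonians -/

section Brackets

variable {p ε : ℕ} {U : TopologicalSpace.Opens (PhaseSpace (p + 2))}

theorem qsHam_apply (m : ℕ) (hU : ∀ x ∈ U, Function.Injective x.1) (j : Fin (p + 2))
    {x : PhaseSpace (p + 2)} (hx : x ∈ U) : (qsHam m U hU j).1 x = sepSolution m x j := by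
  have hx' : x ∈ (U : Set (PhaseSpace (p + 2))) := hx
  change (U : Set (PhaseSpace (p + 2))).indicator (fun x => sepSolution m x j) x = _
  rw [Set.indicator_of_mem hx']

theorem sum_qsHam (hε : ε = 0 ∨ ε = 1) (hU : ∀ x ∈ U, Function.Injective x.1) (i : Fin (p + 2))
    {x : PhaseSpace (p + 2)} (hx : x ∈ U) :
    ∑ j : Fin (p + 2), x.1 i ^ (p + 1 - (j : ℕ)) * (qsHam (p + 2 + ε) U hU j).1 x
      = qsRhs p ε i x := by
  rw [← sepRhs_eq_qsRhs p ε hε, ← sepSolution_spec _ (hU x hx)]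
  exact Finset.sum_congr rfl fun j _ => by rw [qsHam_apply _ hU j hx]; rfl

/-- Since `V h = F` holds on the whole open set `U`, it may be differentiated; the second term on
the right is the derivative of the powers of `λ_i`. -/
theorem sum_fderiv_qsHam (hε : ε = 0 ∨ ε = 1) (hU : ∀ x ∈ U, Function.Injective x.1)
    (i : Fin (p + 2)) {x : PhaseSpace (p + 2)} (hx : x ∈ U) (v : PhaseSpace (p + 2)) :
    ∑ j : Fin (p + 2), x.1 i ^ (p + 1 - (j : ℕ)) * fderiv ℝ (qsHam (p + 2 + ε) U hU j).1 x v
      = fderiv ℝ (qsRhs p ε i) x v - v.1 i * ∑ j : Fin (p + 2),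
        (((p + 1 - (j : ℕ) : ℕ) : ℝ) * x.1 i ^ (p + 1 - (j : ℕ) - 1))
          * (qsHam (p + 2 + ε) U hU j).1 x := by
  have hev : (fun y : PhaseSpace (p + 2) => ∑ j : Fin (p + 2),
      y.1 i ^ (p + 1 - (j : ℕ)) * (qsHam (p + 2 + ε) U hU j).1 y) =ᶠ[nhds x] qsRhs p ε i := by
    filter_upwards [U.isOpen.mem_nhds hx] with y hy using sum_qsHam hε hU i hy
  have hl : HasFDerivAt (fun y : PhaseSpace (p + 2) => y.1 i)
      ((ContinuousLinearMap.proj i).comp (ContinuousLinearMap.fst ℝ _ _)) x :=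
    ((ContinuousLinearMap.proj i).comp (ContinuousLinearMap.fst ℝ _ _) :
      PhaseSpace (p + 2) →L[ℝ] ℝ).hasFDerivAt
  have hd := HasFDerivAt.fun_sum (u := Finset.univ) fun (j : Fin (p + 2)) _ =>
    (hl.pow (p + 1 - (j : ℕ))).mul
      (SmoothFun.differentiableAt (qsHam (p + 2 + ε) U hU j) hx).hasFDerivAt
  have hd' : fderiv ℝ (fun y : PhaseSpace (p + 2) => ∑ j : Fin (p + 2),
      y.1 i ^ (p + 1 - (j : ℕ)) * (qsHam (p + 2 + ε) U hU j).1 y) x = _ := hd.fderiv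
  rw [← hev.fderiv_eq, hd', _root_.sum_apply, Finset.mul_sum, ← Finset.sum_sub_distrib]
  refine Finset.sum_congr rfl fun j _ => ?_
  simp
  ring

theorem sum_dMu_qsHam (hε : ε = 0 ∨ ε = 1) (hU : ∀ x ∈ U, Function.Injective x.1)
    (i l : Fin (p + 2)) {x : PhaseSpace (p + 2)} (hx : x ∈ U) :
    ∑ j : Fin (p + 2), x.1 i ^ (p + 1 - (j : ℕ)) * dMu l (qsHam (p + 2 + ε) U hU j).1 x
      = dMu l (qsRhs p ε i) x := by
  have := sum_fderiv_qsHam hε hU i hx (0, Pi.single l 1)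
  simpa [dMu] using this

theorem sum_dLam_qsHam (hε : ε = 0 ∨ ε = 1) (hU : ∀ x ∈ U, Function.Injective x.1)
    (i l : Fin (p + 2)) {x : PhaseSpace (p + 2)} (hx : x ∈ U) :
    ∑ j : Fin (p + 2), x.1 i ^ (p + 1 - (j : ℕ)) * dLam l (qsHam (p + 2 + ε) U hU j).1 x
      = dLam l (qsRhs p ε i) x - (Pi.single l 1 : Fin (p + 2) → ℝ) i * ∑ j : Fin (p + 2),
        (((p + 1 - (j : ℕ) : ℕ) : ℝ) * x.1 i ^ (p + 1 - (j : ℕ) - 1))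
          * (qsHam (p + 2 + ε) U hU j).1 x :=
  sum_fderiv_qsHam hε hU i hx (Pi.single l 1, 0)

/-- The left side is the `(i, k)` entry of `V {h, h} Vᵀ`. Row `i` of `V` depends on `λ_i` alone, so
only the pairs at `i` and `k` yield corrections, and these involve only the mixed derivatives
`∂F_i/∂μ_k` and `∂F_k/∂μ_i`. -/
theorem sum_sum_lie_qsHam (hε : ε = 0 ∨ ε = 1) (hU : ∀ x ∈ U, Function.Injective x.1)
    {i k : Fin (p + 2)} (hik : i ≠ k) {x : PhaseSpace (p + 2)} (hx : x ∈ U) :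
    ∑ b : Fin (p + 2), ∑ a : Fin (p + 2), x.1 i ^ (p + 1 - (a : ℕ)) * x.1 k ^ (p + 1 - (b : ℕ))
        * (⁅qsHam (p + 2 + ε) U hU a, qsHam (p + 2 + ε) U hU b⁆ : SmoothFun U).1 x
      = sepBracket p ε (x.1 i) (x.1 k) (qsRhs p ε i x) (qsRhs p ε k x)
        - (∑ j : Fin (p + 2), (((p + 1 - (j : ℕ) : ℕ) : ℝ) * x.1 k ^ (p + 1 - (j : ℕ) - 1))
          * (qsHam (p + 2 + ε) U hU j).1 x)
            * (x.1 i ^ (p + 1) * x.1 k ^ (ε + 1) / (x.1 i - x.1 k))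
        + (∑ j : Fin (p + 2), (((p + 1 - (j : ℕ) : ℕ) : ℝ) * x.1 i ^ (p + 1 - (j : ℕ) - 1))
          * (qsHam (p + 2 + ε) U hU j).1 x)
            * (x.1 k ^ (p + 1) * x.1 i ^ (ε + 1) / (x.1 k - x.1 i)) := by
  rw [← bracket_qsRhs p ε hε hik (hU x hx), ← dMu_qsRhs_of_ne p ε hik.symm (hU x hx),
    ← dMu_qsRhs_of_ne p ε hik (hU x hx)]
  have e : ∑ b : Fin (p + 2), ∑ a : Fin (p + 2),
      x.1 i ^ (p + 1 - (a : ℕ)) * x.1 k ^ (p + 1 - (b : ℕ))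
        * (⁅qsHam (p + 2 + ε) U hU a, qsHam (p + 2 + ε) U hU b⁆ : SmoothFun U).1 x
      = ∑ l, ((∑ a : Fin (p + 2),
            x.1 i ^ (p + 1 - (a : ℕ)) * dMu l (qsHam (p + 2 + ε) U hU a).1 x)
          * (∑ b : Fin (p + 2),
            x.1 k ^ (p + 1 - (b : ℕ)) * dLam l (qsHam (p + 2 + ε) U hU b).1 x)
        - (∑ a : Fin (p + 2),
            x.1 i ^ (p + 1 - (a : ℕ)) * dLam l (qsHam (p + 2 + ε) U hU a).1 x)
          * (∑ b : Fin (p + 2),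
            x.1 k ^ (p + 1 - (b : ℕ)) * dMu l (qsHam (p + 2 + ε) U hU b).1 x)) := by
    have hl : ∀ l : Fin (p + 2), _ := fun l => congrArg₂ (· - ·)
      (Finset.sum_mul_sum Finset.univ Finset.univ
        (fun a : Fin (p + 2) =>
          x.1 i ^ (p + 1 - (a : ℕ)) * dMu l (qsHam (p + 2 + ε) U hU a).1 x)
        (fun b : Fin (p + 2) =>
          x.1 k ^ (p + 1 - (b : ℕ)) * dLam l (qsHam (p + 2 + ε) U hU b).1 x))
      (Finset.sum_mul_sum Finset.univ Finset.univ
        (fun a : Fin (p + 2) =>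
          x.1 i ^ (p + 1 - (a : ℕ)) * dLam l (qsHam (p + 2 + ε) U hU a).1 x)
        (fun b : Fin (p + 2) =>
          x.1 k ^ (p + 1 - (b : ℕ)) * dMu l (qsHam (p + 2 + ε) U hU b).1 x))
    rw [Finset.sum_congr rfl fun l _ => hl l]
    simp only [SmoothFun.lie_apply _ _ hx, Finset.mul_sum, ← Finset.sum_sub_distrib]
    rw [Finset.sum_comm, Finset.sum_congr rfl fun a _ => Finset.sum_comm, Finset.sum_comm]
    refine Finset.sum_congr rfl fun l _ => Finset.sum_congr rfl fun a _ =>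
      Finset.sum_congr rfl fun b _ => ?_
    ring
  rw [e]
  simp only [sum_dMu_qsHam hε hU _ _ hx, sum_dLam_qsHam hε hU _ _ hx, mul_sub, sub_mul,
    Finset.sum_sub_distrib]
  have s1 : ∀ (w : ℝ) (k : Fin (p + 2)) (f : Fin (p + 2) → ℝ),
      ∑ l, f l * ((Pi.single l 1 : Fin (p + 2) → ℝ) k * w) = f k * w := fun w k f => by
    rw [Finset.sum_eq_single k (fun l _ hl => by simp [Pi.single_eq_of_ne hl.symm]) (by simp)]
    simp
  have s2 : ∀ (w : ℝ) (k : Fin (p + 2)) (f : Fin (p + 2) → ℝ),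
      ∑ l, (Pi.single l 1 : Fin (p + 2) → ℝ) k * w * f l = f k * w := fun w k f => by
    rw [← s1]
    exact Finset.sum_congr rfl fun l _ => by ring
  rw [s1, s2]
  ring

theorem lie_qsHam (hε : ε = 0 ∨ ε = 1) (hU : ∀ x ∈ U, Function.Injective x.1)
    (a b : Fin (p + 2)) :
    ⁅qsHam (p + 2 + ε) U hU a, qsHam (p + 2 + ε) U hU b⁆
      = ∑ q : Fin (p + 2), qsConst ε a b q • qsHam (p + 2 + ε) U hU q := by
  refine SmoothFun.ext_on fun x hx => ?_
  have hsum : ∀ a b : Fin (p + 2),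
      (∑ q : Fin (p + 2), qsConst ε a b q • qsHam (p + 2 + ε) U hU q : SmoothFun U).1 x
        = ∑ q : Fin (p + 2), qsConst ε a b q * (qsHam (p + 2 + ε) U hU q).1 x := fun a b => by
    simp
  rw [hsum]
  set A : Matrix (Fin (p + 2)) (Fin (p + 2)) ℝ := Matrix.of fun a b =>
    (⁅qsHam (p + 2 + ε) U hU a, qsHam (p + 2 + ε) U hU b⁆ : SmoothFun U).1 x
      - ∑ q : Fin (p + 2), qsConst ε a b q * (qsHam (p + 2 + ε) U hU q).1 x with hA
  have hanti : ∀ a b, A b a = -A a b := fun a b => by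
    simp only [hA, Matrix.of_apply]
    have h1 : (⁅qsHam (p + 2 + ε) U hU b, qsHam (p + 2 + ε) U hU a⁆ : SmoothFun U).1 x
        = -(⁅qsHam (p + 2 + ε) U hU a, qsHam (p + 2 + ε) U hU b⁆ : SmoothFun U).1 x := by
      rw [← lie_skew]
      rfl
    simp only [h1, qsConst_swap ε a b, neg_mul, Finset.sum_neg_distrib]
    ring
  have hentry : ∀ i k, (sepMatrix x * A * (sepMatrix x).transpose) i k
      = ∑ b : Fin (p + 2), ∑ a : Fin (p + 2),
        x.1 i ^ (p + 1 - (a : ℕ)) * x.1 k ^ (p + 1 - (b : ℕ)) * A a b := fun i k => by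
    simp only [Matrix.mul_apply, Matrix.transpose_apply, Finset.sum_mul]
    refine Finset.sum_congr rfl fun b _ => Finset.sum_congr rfl fun a _ => ?_
    simp only [sepMatrix, Matrix.of_apply, Nat.add_succ_sub_one]
    ring
  have hzero : sepMatrix x * A * (sepMatrix x).transpose = 0 := by
    ext i k
    rw [hentry, Matrix.zero_apply]
    by_cases hik : i = k
    · subst hik
      -- On the diagonal the quadratic form of an antisymmetric matrix vanishes: add the sum to
      -- itself with `a` and `b` exchanged.
      rw [← add_self_eq_zero]
      nth_rewrite 2 [Finset.sum_comm]
      rw [← Finset.sum_add_distrib]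
      refine Finset.sum_eq_zero fun b _ => ?_
      rw [← Finset.sum_add_distrib]
      refine Finset.sum_eq_zero fun a _ => ?_
      rw [hanti a b]
      ring
    · simp only [hA, Matrix.of_apply, mul_sub, Finset.sum_sub_distrib]
      rw [sum_sum_lie_qsHam hε hU hik hx, sub_eq_zero]
      -- Off the diagonal both sides are linear in the values `h_q(x)`, so it is enough to match the
      -- coefficient of each.
      simp only [Finset.mul_sum]
      rw [Finset.sum_congr rfl fun b _ => Finset.sum_comm, Finset.sum_comm]
      have hq : ∀ q : Fin (p + 2), ∑ b : Fin (p + 2), ∑ a : Fin (p + 2),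
          x.1 i ^ (p + 1 - (a : ℕ)) * x.1 k ^ (p + 1 - (b : ℕ))
            * (qsConst ε a b q * (qsHam (p + 2 + ε) U hU q).1 x)
          = (sepBracket p ε (x.1 i) (x.1 k) (x.1 i ^ (p + 1 - (q : ℕ))) (x.1 k ^ (p + 1 - (q : ℕ)))
            - (((p + 1 - q : ℕ) : ℝ) * x.1 k ^ (p + 1 - (q : ℕ) - 1))
              * (x.1 i ^ (p + 1) * x.1 k ^ (ε + 1) / (x.1 i - x.1 k))
            + (((p + 1 - q : ℕ) : ℝ) * x.1 i ^ (p + 1 - (q : ℕ) - 1))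
              * (x.1 k ^ (p + 1) * x.1 i ^ (ε + 1) / (x.1 k - x.1 i)))
            * (qsHam (p + 2 + ε) U hU q).1 x := fun q => by
        rw [← sum_qsConst p ε q hε (by omega) (fun h => hik (hU x hx h)), Finset.sum_mul,
          ← Fin.sum_univ_eq_sum_range (fun b => (∑ a ∈ Finset.range (p + 2),
            x.1 i ^ (p + 1 - a) * x.1 k ^ (p + 1 - b) * qsConst ε a b q)
              * (qsHam (p + 2 + ε) U hU q).1 x)]
        refine Finset.sum_congr rfl fun b _ => ?_
        rw [Finset.sum_mul, ← Fin.sum_univ_eq_sum_range (fun a =>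
            x.1 i ^ (p + 1 - a) * x.1 k ^ (p + 1 - (b : ℕ)) * qsConst ε a b q
              * (qsHam (p + 2 + ε) U hU q).1 x)]
        exact Finset.sum_congr rfl fun a _ => by ring
      rw [Finset.sum_congr rfl fun q _ => hq q, ← sum_qsHam hε hU i hx, ← sum_qsHam hε hU k hx,
        ← sepBracket_sum]
      simp only [Finset.sum_mul, ← Finset.sum_sub_distrib, ← Finset.sum_add_distrib]
      refine Finset.sum_congr rfl fun q _ => ?_
      simp only [sepBracket]
      ring
  have hunit := sepMatrix_isUnit_det (hU x hx)
  have hA0 : A = 0 := by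
    have h1 := (Matrix.isUnit_iff_isUnit_det _).mpr hunit
    have h2 : IsUnit (sepMatrix x).transpose := by
      rw [Matrix.isUnit_iff_isUnit_det, Matrix.det_transpose]
      exact hunit
    have h3 := (h2.mul_left_eq_zero).mp hzero
    exact (h1.mul_right_eq_zero).mp h3
  exact sub_eq_zero.mp (congrFun (congrFun hA0 a) b)

end Brackets

/-! ### Linear independence and the spanned Lie algebra -/

section Independence

variable {p ε : ℕ} {U : TopologicalSpace.Opens (PhaseSpace (p + 2))}

/-- A symmetric second difference in the momenta annihilates the part linear in them and isolates
the kinetic term. -/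
theorem qsRhs_second_difference {N : ℕ} (p ε : ℕ) (k : Fin N) (l u β : Fin N → ℝ) :
    qsRhs p ε k (l, u + β) + qsRhs p ε k (l, u - β) - 2 * qsRhs p ε k (l, u)
      = l k ^ (p + 2 + ε) * β k ^ 2 := by
  have hs : ∑ j ∈ Finset.univ.erase k, (l k ^ (ε + 1) * (u + β) k - l j ^ (ε + 1) * (u + β) j)
        / (l k - l j)
      = 2 * (∑ j ∈ Finset.univ.erase k, (l k ^ (ε + 1) * u k - l j ^ (ε + 1) * u j)
        / (l k - l j))
      - ∑ j ∈ Finset.univ.erase k, (l k ^ (ε + 1) * (u - β) k - l j ^ (ε + 1) * (u - β) j)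
        / (l k - l j) := by
    rw [Finset.mul_sum, ← Finset.sum_sub_distrib]
    refine Finset.sum_congr rfl fun j _ => ?_
    simp only [Pi.add_apply, Pi.sub_apply]
    ring
  simp only [qsRhs]
  rw [hs]
  simp only [Pi.add_apply, Pi.sub_apply]
  ring

/-- A small common shift of all the `λ_i` stays in `U` and avoids the finitely many values at which
some coordinate vanishes. -/
theorem exists_mem_forall_ne_zero {n : ℕ} {U : TopologicalSpace.Opens (PhaseSpace n)}
    (hne : (U : Set (PhaseSpace n)).Nonempty) : ∃ x ∈ U, ∀ i, x.1 i ≠ 0 := by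
  obtain ⟨x, hx⟩ := hne
  have hc : Continuous fun t : ℝ => x + t • ((1, 0) : PhaseSpace n) := by fun_prop
  have h1 : ∀ᶠ t in nhdsWithin (0 : ℝ) {0}ᶜ, x + t • ((1, 0) : PhaseSpace n) ∈ U := by
    refine Filter.Eventually.filter_mono nhdsWithin_le_nhds ?_
    exact hc.continuousAt.eventually_mem (U.isOpen.mem_nhds (by simpa using hx))
  have h2 : ∀ᶠ t in nhdsWithin (0 : ℝ) {0}ᶜ, ∀ i, x.1 i + t ≠ 0 := by
    rw [Filter.eventually_all]
    intro i
    by_cases hi : x.1 i = 0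
    · filter_upwards [self_mem_nhdsWithin] with t ht
      simpa [hi] using ht
    · refine Filter.Eventually.filter_mono nhdsWithin_le_nhds ?_
      have : Continuous fun t : ℝ => x.1 i + t := by fun_prop
      exact this.continuousAt.eventually_ne (by simpa using hi)
  obtain ⟨t, ht, ht'⟩ := (h1.and h2).exists
  exact ⟨_, ht, fun i => by simpa using ht' i⟩

theorem linearIndependent_qsHam (hε : ε = 0 ∨ ε = 1)
    (hne : (U : Set (PhaseSpace (p + 2))).Nonempty) (hU : ∀ x ∈ U, Function.Injective x.1) :
    LinearIndependent ℝ (qsHam (p + 2 + ε) U hU) := by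
  rw [Fintype.linearIndependent_iff]
  intro c hc
  obtain ⟨x, hx, hx0⟩ := exists_mem_forall_ne_zero hne
  -- With `c = d V`, the relation `∑ c_j h_j = 0` becomes `∑ d_k F_k = 0` at all points of `U` with
  -- the same `λ`, because `V` does not depend on the momenta.
  set d : Fin (p + 2) → ℝ := Matrix.vecMul c (sepMatrix x)⁻¹ with hd
  have hcd : Matrix.vecMul d (sepMatrix x) = c := by
    rw [hd, Matrix.vecMul_vecMul, Matrix.nonsing_inv_mul _ (sepMatrix_isUnit_det (hU x hx)),
      Matrix.vecMul_one]
  have hg : ∀ u : Fin (p + 2) → ℝ, ((x.1, u) : PhaseSpace (p + 2)) ∈ U →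
      ∑ k, d k * qsRhs p ε k (x.1, u) = 0 := by
    intro u hu
    have h0 : ∑ j, c j * (qsHam (p + 2 + ε) U hU j).1 (x.1, u) = 0 := by
      have := congrArg (fun f : SmoothFun U => f.1 (x.1, u)) hc
      simpa using this
    rw [← h0]
    simp only [← sum_qsHam hε hU _ hu, Finset.mul_sum]
    rw [Finset.sum_comm]
    refine Finset.sum_congr rfl fun j _ => ?_
    rw [← congrFun hcd j, Matrix.vecMul, dotProduct, Finset.sum_mul]
    refine Finset.sum_congr rfl fun k _ => ?_
    simp only [sepMatrix, Matrix.of_apply, Nat.add_succ_sub_one]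
    ring
  have hd0 : d = 0 := by
    funext i
    have hc : Continuous fun t : ℝ => ((x.1, x.2 + t • Pi.single i 1) : PhaseSpace (p + 2)) := by
      fun_prop
    have hc' : Continuous fun t : ℝ =>
        ((x.1, x.2 - t • Pi.single i 1) : PhaseSpace (p + 2)) := by
      fun_prop
    have h1 := (hc.continuousAt (x := 0)).eventually_mem (U.isOpen.mem_nhds (by simpa using hx))
    have h2 := (hc'.continuousAt (x := 0)).eventually_mem (U.isOpen.mem_nhds (by simpa using hx))
    have h3 := (h1.and h2).filter_mono (nhdsWithin_le_nhds (s := ({0}ᶜ : Set ℝ)))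
    obtain ⟨t, ⟨ht1, ht2⟩, ht⟩ := (h3.and self_mem_nhdsWithin).exists
    have key : ∑ k, d k * (x.1 k ^ (p + 2 + ε) * (t • Pi.single i 1 : Fin (p + 2) → ℝ) k ^ 2)
        = 0 := by
      simp only [← qsRhs_second_difference p ε _ x.1 x.2, mul_sub, mul_add,
        Finset.sum_sub_distrib, Finset.sum_add_distrib]
      rw [hg _ ht1, hg _ ht2]
      simp only [mul_left_comm _ (2 : ℝ), ← Finset.mul_sum]
      rw [hg _ hx]
      simp
    rw [Finset.sum_eq_single i (fun k _ hk => by simp [Pi.single_eq_of_ne hk]) (by simp)] at key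
    have ht' : t ≠ 0 := ht
    simpa [hx0 i, ht'] using key
  intro j
  rw [← hcd, hd0]
  simp

/-- The Lie algebra spanned by the quasi-Stäckel Hamiltonians. -/
def qsLieSubalgebra (hε : ε = 0 ∨ ε = 1) (hU : ∀ x ∈ U, Function.Injective x.1) :
    LieSubalgebra ℝ (SmoothFun U) where
  toSubmodule := Submodule.span ℝ (Set.range (qsHam (p + 2 + ε) U hU))
  lie_mem' := by
    intro f g hf hg
    refine Submodule.span_induction₂ (p := fun f g _ _ =>
      ⁅f, g⁆ ∈ Submodule.span ℝ (Set.range (qsHam (p + 2 + ε) U hU))) ?_ ?_ ?_ ?_ ?_ ?_ ?_ hf hg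
    · rintro _ _ ⟨a, rfl⟩ ⟨b, rfl⟩
      rw [lie_qsHam hε hU]
      exact Submodule.sum_mem _ fun q _ =>
        Submodule.smul_mem _ _ (Submodule.subset_span ⟨q, rfl⟩)
    · intro g _
      simp
    · intro g _
      simp
    · intro f f' g _ _ _ h h'
      rw [add_lie]
      exact Submodule.add_mem _ h h'
    · intro f g g' _ _ _ h h'
      rw [lie_add]
      exact Submodule.add_mem _ h h'
    · intro r f g _ _ h
      rw [smul_lie]
      exact Submodule.smul_mem _ _ h
    · intro r f g _ _ h
      rw [lie_smul]
      exact Submodule.smul_mem _ _ h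

/-- The quasi-Stäckel Hamiltonians as a basis of the Lie algebra that they span. -/
def qsBasis (hε : ε = 0 ∨ ε = 1) (hne : (U : Set (PhaseSpace (p + 2))).Nonempty)
    (hU : ∀ x ∈ U, Function.Injective x.1) :
    Module.Basis (Fin (p + 2)) ℝ (qsLieSubalgebra hε hU) :=
  Module.Basis.span (linearIndependent_qsHam hε hne hU)

theorem coe_qsBasis (hε : ε = 0 ∨ ε = 1) (hne : (U : Set (PhaseSpace (p + 2))).Nonempty)
    (hU : ∀ x ∈ U, Function.Injective x.1) (i : Fin (p + 2)) :
    (qsBasis hε hne hU i : SmoothFun U) = qsHam (p + 2 + ε) U hU i :=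
  congrArg Subtype.val (Module.Basis.span_apply (linearIndependent_qsHam hε hne hU) i)

theorem lie_qsBasis (hε : ε = 0 ∨ ε = 1) (hne : (U : Set (PhaseSpace (p + 2))).Nonempty)
    (hU : ∀ x ∈ U, Function.Injective x.1) (a b : Fin (p + 2)) :
    ⁅qsBasis hε hne hU a, qsBasis hε hne hU b⁆
      = ∑ q : Fin (p + 2), qsConst ε a b q • qsBasis hε hne hU q := by
  apply Subtype.ext
  rw [LieSubalgebra.coe_bracket, coe_qsBasis, coe_qsBasis, lie_qsHam hε hU]
  rw [AddSubmonoidClass.coe_finsetSum]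
  refine Finset.sum_congr rfl fun q _ => ?_
  rw [← coe_qsBasis hε hne hU]
  rfl

end Independence

/-! ### Center, Abelian subalgebra and triangularity from the structure constants -/

section Structure

variable {n ε : ℕ} {L : Type*} [LieRing L] [LieAlgebra ℝ L] {b : Module.Basis (Fin n) ℝ L}

/-- The basis `b` has the structure constants of the algebra of quasi-Stäckel Hamiltonians. -/
def HasQsConst (ε : ℕ) (b : Module.Basis (Fin n) ℝ L) : Prop :=
  ∀ a c : Fin n, ⁅b a, b c⁆ = ∑ q : Fin n, qsConst ε a c q • b q

theorem HasQsConst.lie_eq (hb : HasQsConst ε b) {a c q : Fin n} (ha : 1 ≤ a.val)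
    (hc : 1 ≤ c.val) (hq : a.val + c + ε = q + 1) : ⁅b a, b c⁆ = ((c : ℝ) - a) • b q := by
  rw [hb, Finset.sum_eq_single q]
  · rw [qsConst, if_pos ⟨ha, hc, hq⟩]
  · intro r _ hr
    rw [qsConst, if_neg (fun h => hr (Fin.ext (by omega))), zero_smul]
  · simp

theorem HasQsConst.lie_eq_zero (hb : HasQsConst ε b) {a c : Fin n}
    (h : a.val = 0 ∨ c.val = 0 ∨ a = c ∨ n < a.val + c + ε) : ⁅b a, b c⁆ = 0 := by
  by_cases hac : a = c
  · rw [hac, lie_self]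
  · rw [hb]
    refine Finset.sum_eq_zero fun q _ => ?_
    rw [qsConst, if_neg (by omega), zero_smul]

/-- For fixed `c`, distinct basis vectors are sent by `ad b_c` to multiples of distinct basis
vectors. Hence the component of `⁅b c, x⁆` of index `a + c + ε - 1` is a nonzero multiple of the
coordinate of `x` at `a`. -/
theorem HasQsConst.repr_eq_zero_of_central (hb : HasQsConst ε b) {x : L}
    (hx : ∀ y : L, ⁅y, x⁆ = 0) {a c : Fin n} (ha : 1 ≤ a.val) (hc : 1 ≤ c.val) (hac : a ≠ c)
    (h : a.val + c + ε ≤ n) : b.repr x a = 0 := by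
  have h0 := hx (b c)
  rw [← b.sum_repr x, lie_sum] at h0
  have h1 := congrArg (fun y => b.repr y ⟨a.val + c + ε - 1, by omega⟩) h0
  simp only [lie_smul, hb c, map_sum, map_smul, Finsupp.coe_finsetSum, Finset.sum_apply,
    Finsupp.smul_apply, Module.Basis.repr_self, map_zero, Finsupp.zero_apply, smul_eq_mul,
    Finsupp.single_apply, mul_ite, mul_one, mul_zero, Finset.sum_ite_eq', Finset.mem_univ,
    if_true] at h1
  rw [Finset.sum_eq_single a] at h1
  · rw [qsConst, if_pos ⟨hc, ha, by omega⟩, mul_eq_zero] at h1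
    refine h1.resolve_right (sub_ne_zero.mpr fun h => hac (Fin.ext ?_))
    exact_mod_cast h
  · intro r _ hr
    rw [qsConst, if_neg (fun h => hr (Fin.ext (by omega))), mul_zero]
  · simp

theorem reorder_val (i : Fin n) :
    (reorder n i).val = if i.val = 0 then 0 else n - i.val := by
  change (if h : i.val = 0 then i else (⟨n - i.val, _⟩ : Fin n)).val = _
  split_ifs with h
  · exact h
  · rfl

theorem reorder_reorder (i : Fin n) : reorder n (reorder n i) = i := by
  apply Fin.ext
  rw [reorder_val, reorder_val]
  split_ifs <;> omega

theorem reorder_symm : (reorder n).symm = reorder n :=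
  Equiv.ext fun i => by rw [Equiv.symm_apply_eq, reorder_reorder]

theorem exists_lieSubalgebra_isLieAbelian {s : Set L} (hs : ∀ x ∈ s, ∀ y ∈ s, ⁅x, y⁆ = 0) :
    ∃ A : LieSubalgebra ℝ L, A.toSubmodule = Submodule.span ℝ s ∧ IsLieAbelian A := by
  have h : ∀ x y, x ∈ Submodule.span ℝ s → y ∈ Submodule.span ℝ s → ⁅x, y⁆ = 0 := by
    intro x y hx hy
    refine Submodule.span_induction₂ (p := fun x y _ _ => ⁅x, y⁆ = 0) ?_ ?_ ?_ ?_ ?_ ?_ ?_ hx hy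
    · exact fun x y hx hy => hs x hx y hy
    · simp
    · simp
    · intro x y z _ _ _ h h'
      rw [add_lie, h, h', add_zero]
    · intro x y z _ _ _ h h'
      rw [lie_add, h, h', add_zero]
    · intro r x y _ _ h
      rw [smul_lie, h, smul_zero]
    · intro r x y _ _ h
      rw [lie_smul, h, smul_zero]
  refine ⟨{ Submodule.span ℝ s with lie_mem' := fun {x y} hx hy => ?_ }, rfl, ⟨?_⟩⟩
  · rw [h x y hx hy]
    exact Submodule.zero_mem _
  · rintro ⟨x, hx⟩ ⟨y, hy⟩
    exact Subtype.ext (h x y hx hy)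

theorem HasQsConst.deformationHypotheses (hb : HasQsConst ε b) (hε : ε = 0 ∨ ε = 1)
    (hn : 2 ≤ n) :
    DeformationHypotheses (b.reindex (reorder n).symm) (centerDim n (n + ε))
      ((n + ε) / 2 + 1) := by
  have hb' : ∀ i, b.reindex (reorder n).symm i = b (reorder n i) := fun i => by simp
  have hv := fun i : Fin n => reorder_val i
  have hdc : centerDim n (n + ε)
      = if ε = 0 then (if n = 2 then 2 else 1) else (if n = 3 then 3 else 2) := by
    rcases hε with rfl | rfl <;> simp [centerDim]
  refine ⟨?_, ?_, ?_, ?_, ?_, ?_⟩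
  · rw [hdc]
    split_ifs <;> omega
  · rw [hdc]
    split_ifs <;> omega
  · omega
  · ext x
    rw [LieSubmodule.mem_toSubmodule, Module.Basis.mem_span_image]
    constructor
    · intro hx i hi
      by_contra hi'
      rw [Set.mem_ofPred_eq, hdc] at hi'
      have hx' : ∀ y : L, ⁅y, x⁆ = 0 := fun y => (LieModule.mem_maxTrivSubmodule ℝ L L x).mp hx y
      refine Finsupp.mem_support_iff.mp hi ?_
      rw [Module.Basis.repr_reindex_apply, Equiv.symm_symm]
      have hvi := hv i
      -- A noncentral basis vector is detected by `h_1`, or by `h_2` when it is `h_1` itself. For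
      -- `(n, m) = (2, 2)` and `(3, 4)` no such pair exists, whence the exceptional values of
      -- `centerDim`.
      have hc : ∃ c : ℕ, 1 ≤ c ∧ c < n ∧ (reorder n i).val ≠ c
          ∧ (reorder n i).val + c + ε ≤ n := by
        by_cases h1 : (reorder n i).val = 1
        · exact ⟨2, by split_ifs at hi' hvi <;> omega⟩
        · exact ⟨1, by split_ifs at hi' hvi <;> omega⟩
      obtain ⟨c, hc1, hcn, hne, hle⟩ := hc
      exact hb.repr_eq_zero_of_central hx' (c := ⟨c, hcn⟩)
        (by split_ifs at hi' hvi <;> omega) hc1 (fun h => hne (congrArg Fin.val h)) hle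
    · intro hx
      have hmem := (Module.Basis.mem_span_image (b.reindex (reorder n).symm)).mpr hx
      refine Submodule.span_le (p := (LieAlgebra.center ℝ L).toSubmodule).mpr ?_ hmem
      rintro _ ⟨i, hi, rfl⟩
      rw [Set.mem_ofPred_eq, hdc] at hi
      rw [SetLike.mem_coe, LieSubmodule.mem_toSubmodule, LieModule.mem_maxTrivSubmodule]
      intro y
      rw [← b.sum_repr y, sum_lie]
      refine Finset.sum_eq_zero fun a _ => ?_
      rw [smul_lie, hb', hb.lie_eq_zero, smul_zero]
      have hvi := hv i
      have ha := a.isLt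
      by_cases h0 : i.val = 0
      · rw [if_pos h0] at hvi
        exact Or.inr (Or.inl hvi)
      · rw [if_neg h0] at hvi
        rw [Fin.ext_iff]
        split_ifs at hi <;> omega
  · refine exists_lieSubalgebra_isLieAbelian ?_
    rintro _ ⟨i, hi, rfl⟩ _ ⟨j, hj, rfl⟩
    rw [Set.mem_ofPred_eq] at hi hj
    rw [hb', hb', hb.lie_eq_zero]
    have hvi := hv i
    have hvj := hv j
    rw [EmbeddingLike.apply_eq_iff_eq, Fin.ext_iff]
    split_ifs at hvi hvj <;> omega
  · intro i j hi hj
    rw [hb', hb']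
    have hvi := hv i
    have hvj := hv j
    by_cases h : (reorder n i).val = 0 ∨ (reorder n j).val = 0
      ∨ n < (reorder n i).val + reorder n j + ε
    · rw [hb.lie_eq_zero (by tauto)]
      exact Submodule.zero_mem _
    · push Not at h
      -- The double `reorder` presents the bracket as a multiple of a reordered basis vector; its
      -- new index lies below both others because `reorder` reverses the nonzero indices.
      rw [hb.lie_eq (q := reorder n (reorder n
        ⟨(reorder n i).val + reorder n j + ε - 1, by omega⟩)) (by omega) (by omega) (by
          rw [reorder_reorder]
          simp only
          omega), ← hb']
      refine Submodule.smul_mem _ _ (Submodule.subset_span ⟨_, ?_, rfl⟩)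
      rw [Set.mem_ofPred_eq, Fin.lt_def, Fin.lt_def, hv]
      simp only
      split_ifs at hvi hvj <;> split_ifs <;> omega

end Structure

open Finset.HasAntidiagonal (antidiagonal)

/-! ### Coefficients of time polynomials and uniqueness of solutions -/

section Coefficients

variable {n : ℕ} {L : Type*} [LieRing L] [LieAlgebra ℝ L]

/-- The coefficient of the monomial `t ^ s` of an element of `L[t_1, …, t_n]`. -/
def tcoeff (s : Fin n →₀ ℕ) : TimePoly n L →ₗ[ℝ] L :=
  (TensorProduct.lid ℝ L).toLinearMap ∘ₗ LinearMap.rTensor L (MvPolynomial.lcoeff ℝ s)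

@[simp]
theorem tcoeff_tmul (s : Fin n →₀ ℕ) (q : MvPolynomial (Fin n) ℝ) (x : L) :
    tcoeff s (q ⊗ₜ[ℝ] x) = q.coeff s • x := by
  simp [tcoeff]

theorem TimePoly.ext_tcoeff {u v : TimePoly n L} (h : ∀ s, tcoeff s u = tcoeff s v) : u = v := by
  refine (TensorProduct.equivFinsuppOfBasisLeft
    (MvPolynomial.basisMonomials (Fin n) ℝ)).injective (Finsupp.ext fun s => ?_)
  rw [TensorProduct.equivFinsuppOfBasisLeft_apply, TensorProduct.equivFinsuppOfBasisLeft_apply]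
  exact h s

theorem TimePoly.add_lie (u v w : TimePoly n L) : ⁅u + v, w⁆ = ⁅u, w⁆ + ⁅v, w⁆ :=
  _root_.add_lie u v w

theorem TimePoly.lie_add (u v w : TimePoly n L) : ⁅u, v + w⁆ = ⁅u, v⁆ + ⁅u, w⁆ :=
  _root_.lie_add u v w

theorem TimePoly.lie_sub (u v w : TimePoly n L) : ⁅u, v - w⁆ = ⁅u, v⁆ - ⁅u, w⁆ :=
  _root_.lie_sub u v w

theorem TimePoly.zero_lie (u : TimePoly n L) : ⁅(0 : TimePoly n L), u⁆ = 0 :=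
  _root_.zero_lie u

theorem TimePoly.lie_zero (u : TimePoly n L) : ⁅u, (0 : TimePoly n L)⁆ = 0 :=
  _root_.lie_zero u

theorem TimePoly.lie_skew (u v : TimePoly n L) : -⁅u, v⁆ = ⁅v, u⁆ :=
  _root_.lie_skew v u

@[simp]
theorem timeDeriv_tmul (j : Fin n) (q : MvPolynomial (Fin n) ℝ) (x : L) :
    timeDeriv j (q ⊗ₜ[ℝ] x) = MvPolynomial.pderiv j q ⊗ₜ[ℝ] x := rfl

theorem tcoeff_timeDeriv (j : Fin n) (s : Fin n →₀ ℕ) (u : TimePoly n L) :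
    tcoeff s (timeDeriv j u) = ((s j : ℝ) + 1) • tcoeff (s + Finsupp.single j 1) u := by
  induction u using TensorProduct.induction_on with
  | zero => simp
  | add u v hu hv => rw [map_add, map_add, map_add, hu, hv, smul_add]
  | tmul q x => simp [MvPolynomial.coeff_pderiv, mul_smul, smul_comm ((s j : ℝ) + 1)]

theorem tcoeff_lie (s : Fin n →₀ ℕ) (u v : TimePoly n L) :
    tcoeff s ⁅u, v⁆ = ∑ a ∈ antidiagonal s, ⁅tcoeff a.1 u, tcoeff a.2 v⁆ := by
  induction u using TensorProduct.induction_on with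
  | zero => simp [TimePoly.zero_lie]
  | add u u' hu hu' => simp [TimePoly.add_lie, hu, hu', Finset.sum_add_distrib]
  | tmul q x =>
    induction v using TensorProduct.induction_on with
    | zero => simp [TimePoly.lie_zero]
    | add v v' hv hv' => simp only [TimePoly.lie_add, map_add, hv, hv', _root_.lie_add,
        Finset.sum_add_distrib]
    | tmul q' y =>
      rw [LieAlgebra.ExtendScalars.bracket_tmul, tcoeff_tmul, MvPolynomial.coeff_mul,
        Finset.sum_smul]
      refine Finset.sum_congr rfl fun a _ => ?_
      rw [tcoeff_tmul, tcoeff_tmul, smul_lie, lie_smul, smul_smul]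

theorem atZero_eq_tcoeff (u : TimePoly n L) : atZero u = tcoeff 0 u := by
  induction u using TensorProduct.induction_on with
  | zero => simp
  | add u v hu hv => rw [map_add, map_add, hu, hv]
  | tmul q x =>
    simp [atZero, MvPolynomial.aeval_def, ← MvPolynomial.constantCoeff_eq,
      MvPolynomial.eval₂_zero'_apply]

/-- The equation expresses each coefficient of positive degree of `u` by coefficients of strictly
lower degree, so all vanish by induction from the constant one. -/
theorem eq_zero_of_timeDeriv_eq_lie {u : TimePoly n L} (A : Fin n → TimePoly n L)
    (h : ∀ j, timeDeriv j u = ⁅A j, u⁆) (h0 : atZero u = 0) : u = 0 := by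
  refine TimePoly.ext_tcoeff fun s => ?_
  rw [map_zero]
  induction hd : s.degree using Nat.strong_induction_on generalizing s with
  | _ d ih =>
    by_cases hs : s = 0
    · rw [hs, ← atZero_eq_tcoeff, h0]
    · obtain ⟨j, hj⟩ := Finsupp.ne_iff.mp hs
      have hj' : Finsupp.single j 1 ≤ s := by
        rw [Finsupp.single_le_iff]
        exact Nat.one_le_iff_ne_zero.mpr hj
      set s' := s - Finsupp.single j 1 with hs'
      have e : s' + Finsupp.single j 1 = s := tsub_add_cancel_of_le hj'
      have hdeg : s'.degree + 1 = d := by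
        rw [← hd, ← e, map_add, Finsupp.degree_single]
      have h1 := congrArg (tcoeff s') (h j)
      rw [tcoeff_timeDeriv, e, tcoeff_lie, Finset.sum_eq_zero] at h1
      · exact (smul_eq_zero.mp h1).resolve_left (by positivity)
      · rintro ⟨a, c⟩ hac
        have hac' := Finset.HasAntidiagonal.mem_antidiagonal.mp hac
        simp only at hac' ⊢
        have : c.degree < d := by
          rw [← hdeg, ← hac', map_add]
          omega
        rw [ih _ this c rfl, _root_.lie_zero]

/-- A solution of the Frobenius condition in which the `i`-th member depends on the times with
index greater than `i` only is determined by its value at `t = 0`. -/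
theorem FrobeniusCondition.eq_of_atZero_eq {H K : Fin n → TimePoly n L}
    (hH : FrobeniusCondition H) (hK : FrobeniusCondition K)
    (hH' : ∀ i j, i ≤ j → timeDeriv i (H j) = 0) (hK' : ∀ i j, i ≤ j → timeDeriv i (K j) = 0)
    (h0 : ∀ i, atZero (H i) = atZero (K i)) : H = K := by
  have key : ∀ d : ℕ, ∀ i : Fin n, n - i.val = d → H i = K i := by
    intro d
    induction d using Nat.strong_induction_on with
    | _ d ih =>
      intro i hi
      -- For `j > i` the induction gives `H j = K j`, so both families satisfy the same linear
      -- equation in `t_j`; for `j ≤ i` neither depends on `t_j`.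
      refine sub_eq_zero.mp (eq_zero_of_timeDeriv_eq_lie (fun j => if i < j then H j else 0)
        (fun j => ?_) (by rw [map_sub, h0, sub_self]))
      split_ifs with hij
      · have h1 : ∀ {H : Fin n → TimePoly n L}, FrobeniusCondition H →
            (∀ i j, i ≤ j → timeDeriv i (H j) = 0) → timeDeriv j (H i) = ⁅H j, H i⁆ := by
          intro H hH hH'
          have := hH i j
          rw [hH' i j hij.le, sub_zero, ← TimePoly.lie_skew, ← sub_eq_add_neg] at this
          exact sub_eq_zero.mp this
        have hj : H j = K j := ih (n - j.val) (by have := Fin.lt_def.mp hij; omega) j rfl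
        rw [map_sub, h1 hH hH', h1 hK hK', TimePoly.lie_sub, hj]
      · rw [map_sub, hH' j i (not_lt.mp hij), hK' j i (not_lt.mp hij), TimePoly.zero_lie, sub_zero]
  exact funext fun i => key _ i rfl

theorem timeDeriv_eq_zero_of_mem {S : Set (Fin n)} {u : TimePoly n L} (hu : u ∈ timePolyIn S)
    {j : Fin n} (hj : j ∉ S) : timeDeriv j u = 0 := by
  obtain ⟨v, rfl⟩ := hu
  induction v using TensorProduct.induction_on with
  | zero => simp
  | add v w hv hw => rw [map_add, map_add, hv, hw, add_zero]
  | tmul q x =>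
    have hq : MvPolynomial.pderiv j (q : MvPolynomial (Fin n) ℝ) = 0 :=
      MvPolynomial.pderiv_eq_zero_of_notMem_vars fun h =>
        hj (MvPolynomial.mem_supported.mp q.2 h)
    simp [hq]

theorem tmul_mem_timePolyIn {S : Set (Fin n)} {q : MvPolynomial (Fin n) ℝ}
    (hq : q ∈ MvPolynomial.supported ℝ S) (x : L) : q ⊗ₜ[ℝ] x ∈ timePolyIn (L := L) S :=
  ⟨(⟨q, hq⟩ : MvPolynomial.supported ℝ S) ⊗ₜ x, rfl⟩

/-! ### Permuting the times -/

section Reindexing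

variable (σ : Equiv.Perm (Fin n))

/-- Renaming of the times. -/
def renameTimes : TimePoly n L →ₗ[ℝ] TimePoly n L :=
  LinearMap.rTensor L (MvPolynomial.rename (R := ℝ) σ).toLinearMap

@[simp]
theorem renameTimes_tmul (q : MvPolynomial (Fin n) ℝ) (x : L) :
    renameTimes σ (q ⊗ₜ[ℝ] x) = MvPolynomial.rename σ q ⊗ₜ[ℝ] x := rfl

theorem toOriginalOrder_apply (H : Fin n → TimePoly n L) (i : Fin n) :
    toOriginalOrder σ H i = renameTimes σ (H (σ.symm i)) := rfl

theorem renameTimes_lie (u v : TimePoly n L) :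
    renameTimes σ ⁅u, v⁆ = ⁅renameTimes σ u, renameTimes σ v⁆ := by
  induction u using TensorProduct.induction_on with
  | zero => simp [TimePoly.zero_lie]
  | add u u' hu hu' => simp only [TimePoly.add_lie, map_add, hu, hu']
  | tmul q x =>
    induction v using TensorProduct.induction_on with
    | zero => simp [TimePoly.lie_zero]
    | add v v' hv hv' => simp only [TimePoly.lie_add, map_add, hv, hv']
    | tmul q' y => simp [LieAlgebra.ExtendScalars.bracket_tmul]

theorem timeDeriv_renameTimes (j : Fin n) (u : TimePoly n L) :
    timeDeriv (σ j) (renameTimes σ u) = renameTimes σ (timeDeriv j u) := by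
  induction u using TensorProduct.induction_on with
  | zero => simp
  | add u v hu hv => simp only [map_add, hu, hv]
  | tmul q x => simp [MvPolynomial.pderiv_rename σ.injective]

theorem atZero_renameTimes (u : TimePoly n L) : atZero (renameTimes σ u) = atZero u := by
  induction u using TensorProduct.induction_on with
  | zero => simp
  | add u v hu hv => simp only [map_add, hu, hv]
  | tmul q x =>
    simp [atZero, MvPolynomial.aeval_rename, Function.comp_def]

theorem renameTimes_renameTimes (τ : Equiv.Perm (Fin n)) (u : TimePoly n L) :
    renameTimes σ (renameTimes τ u) = renameTimes (σ * τ) u := by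
  induction u using TensorProduct.induction_on with
  | zero => simp
  | add u v hu hv => simp only [map_add, hu, hv]
  | tmul q x => simp [MvPolynomial.rename_rename]

theorem renameTimes_one (u : TimePoly n L) : renameTimes 1 u = u := by
  induction u using TensorProduct.induction_on with
  | zero => simp
  | add u v hu hv => simp only [map_add, hu, hv]
  | tmul q x => simp

theorem toOriginalOrder_symm (H : Fin n → TimePoly n L) :
    toOriginalOrder σ (toOriginalOrder σ.symm H) = H := by
  funext i
  rw [toOriginalOrder_apply, toOriginalOrder_apply, renameTimes_renameTimes]
  rw [show σ * σ.symm = 1 from mul_inv_cancel σ, renameTimes_one]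
  simp

theorem FrobeniusCondition.toOriginalOrder {H : Fin n → TimePoly n L}
    (hH : FrobeniusCondition H) : FrobeniusCondition (toOriginalOrder σ H) := by
  intro i j
  obtain ⟨i, rfl⟩ := σ.surjective i
  obtain ⟨j, rfl⟩ := σ.surjective j
  simp only [toOriginalOrder_apply, Equiv.symm_apply_apply]
  rw [timeDeriv_renameTimes, timeDeriv_renameTimes, ← renameTimes_lie, ← map_sub, ← map_add,
    hH i j, map_zero]

end Reindexing

end Coefficients

/-! ### Exponentials of nilpotent adjoint actions and their flows -/

section Exponential

variable {T : Type*} [LieRing T] [LieAlgebra ℝ T]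

/-- The exponential series truncated after `K` terms. -/
def expSum {M : Type*} [AddCommGroup M] [Module ℝ M] (K : ℕ) (f : Module.End ℝ M) :
    Module.End ℝ M :=
  ∑ k ∈ Finset.range K, (k.factorial : ℝ)⁻¹ • f ^ k

theorem expSum_apply {M : Type*} [AddCommGroup M] [Module ℝ M] (K : ℕ) (f : Module.End ℝ M)
    (u : M) : expSum K f u = ∑ k ∈ Finset.range K, (k.factorial : ℝ)⁻¹ • (f ^ k) u := by
  simp [expSum]

theorem expSum_ad_lie {K : ℕ} {y : T} (hK : (LieAlgebra.ad ℝ T y) ^ K = 0) (u v : T) :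
    expSum K (LieAlgebra.ad ℝ T y) ⁅u, v⁆
      = ⁅expSum K (LieAlgebra.ad ℝ T y) u, expSum K (LieAlgebra.ad ℝ T y) v⁆ := by
  -- `LieDerivation.exp` has rational coefficients, so scalars are restricted to `ℚ`; it is the
  -- exponential of a nilpotent derivation, hence a Lie automorphism.
  let _ : Module ℚ T := Module.compHom T (algebraMap ℚ ℝ)
  let _ : LieAlgebra ℚ T := { lie_smul := fun q x y => lie_smul (q : ℝ) x y }
  have hD : (LieDerivation.ad ℝ T y).toLinearMap = LieAlgebra.ad ℝ T y := by
    ext z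
    simp
  have hnil : IsNilpotent (LieDerivation.ad ℝ T y).toLinearMap := ⟨K, by rw [hD, hK]⟩
  have he : ∀ z, LieDerivation.exp (LieDerivation.ad ℝ T y) hnil z
      = expSum K (LieAlgebra.ad ℝ T y) z := by
    intro z
    rw [LieDerivation.exp_map_apply, IsNilpotent.exp_eq_sum (k := K) (by rw [hD, hK]), hD,
      expSum_apply, LinearMap.sum_apply]
    refine Finset.sum_congr rfl fun k _ => ?_
    have hq : ∀ (q : ℚ) (f : Module.End ℝ T), (q • f) z = (q : ℝ) • f z := fun q f => rfl
    rw [hq]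
    push_cast
    rfl
  rw [← he, ← he, ← he]
  exact LieEquiv.map_lie _ u v

end Exponential

section Flows

variable {n : ℕ} {L : Type*} [LieRing L] [LieAlgebra ℝ L] (K : ℕ) (h : Fin n → L)

/-- The flow `exp (t_r ad h_r)`, where `ad h_r` is the usual adjoint action. -/
def flow (r : Fin n) : Module.End ℝ (TimePoly n L) :=
  expSum K (LieAlgebra.ad ℝ (TimePoly n L) (MvPolynomial.X r ⊗ₜ h r))

variable {K h}

theorem ad_tmul_pow_apply (k : ℕ) (q p : MvPolynomial (Fin n) ℝ) (y x : L) :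
    ((LieAlgebra.ad ℝ (TimePoly n L) (q ⊗ₜ y)) ^ k) (p ⊗ₜ x)
      = (q ^ k * p) ⊗ₜ[ℝ] ((LieAlgebra.ad ℝ L y) ^ k) x := by
  induction k with
  | zero => simp
  | succ k ih =>
    rw [pow_succ', Module.End.mul_apply, ih, LieAlgebra.ad_apply, pow_succ' (LieAlgebra.ad ℝ L y),
      Module.End.mul_apply, LieAlgebra.ad_apply, pow_succ', mul_assoc]
    exact LieAlgebra.ExtendScalars.bracket_tmul ..

theorem flow_tmul (r : Fin n) (q : MvPolynomial (Fin n) ℝ) (x : L) :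
    flow K h r (q ⊗ₜ x) = ∑ k ∈ Finset.range K, (k.factorial : ℝ)⁻¹ •
      ((MvPolynomial.X r ^ k * q) ⊗ₜ[ℝ] ((LieAlgebra.ad ℝ L (h r)) ^ k) x) := by
  rw [flow, expSum_apply]
  exact Finset.sum_congr rfl fun k _ => by rw [ad_tmul_pow_apply]

theorem flow_lie {r : Fin n} (hr : (LieAlgebra.ad ℝ L (h r)) ^ K = 0) (u v : TimePoly n L) :
    flow K h r ⁅u, v⁆ = ⁅flow K h r u, flow K h r v⁆ := by
  refine expSum_ad_lie ?_ u v
  refine TensorProduct.ext' fun p x => ?_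
  rw [ad_tmul_pow_apply, hr]
  simp

theorem timeDeriv_flow_of_ne {j r : Fin n} (hj : j ≠ r) (u : TimePoly n L) :
    timeDeriv j (flow K h r u) = flow K h r (timeDeriv j u) := by
  induction u using TensorProduct.induction_on with
  | zero => simp
  | add u v hu hv => simp only [map_add, hu, hv]
  | tmul q x =>
    rw [timeDeriv_tmul, flow_tmul, flow_tmul, map_sum]
    refine Finset.sum_congr rfl fun k _ => ?_
    rw [map_smul, timeDeriv_tmul, Derivation.leibniz, Derivation.leibniz_pow,
      MvPolynomial.pderiv_X_of_ne hj.symm]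
    simp

/-- The product rule for `exp (t_r ad h_r) u`. Nilpotency is what makes it exact for the truncated
series: the derivative of the series lacks the term in `(ad h_r)^K`, and that term is zero. -/
theorem timeDeriv_flow {r : Fin n} (hr : (LieAlgebra.ad ℝ L (h r)) ^ K = 0)
    (u : TimePoly n L) :
    timeDeriv r (flow K h r u)
      = ⁅(1 ⊗ₜ h r : TimePoly n L), flow K h r u⁆ + flow K h r (timeDeriv r u) := by
  induction u using TensorProduct.induction_on with
  | zero => simp [TimePoly.lie_zero]
  | add u v hu hv =>
    simp only [map_add, TimePoly.lie_add, hu, hv]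
    abel
  | tmul q x =>
    have hlie : ⁅(1 ⊗ₜ h r : TimePoly n L), flow K h r (q ⊗ₜ x)⁆
        = ∑ k ∈ Finset.range K, (k.factorial : ℝ)⁻¹ •
          ((MvPolynomial.X r ^ k * q) ⊗ₜ[ℝ] ((LieAlgebra.ad ℝ L (h r)) ^ (k + 1)) x) := by
      rw [flow_tmul]
      refine (lie_sum (L := TimePoly n L) ..).trans (Finset.sum_congr rfl fun k _ => ?_)
      refine (lie_smul (R := ℝ) (L := TimePoly n L) (M := TimePoly n L) _ _ _).trans ?_
      rw [LieAlgebra.ExtendScalars.bracket_tmul, one_mul, pow_succ', Module.End.mul_apply,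
        LieAlgebra.ad_apply]
    rw [hlie, timeDeriv_tmul, flow_tmul, flow_tmul, map_sum]
    have hk : ∀ k ∈ Finset.range K, timeDeriv r ((k.factorial : ℝ)⁻¹ •
          ((MvPolynomial.X r ^ k * q) ⊗ₜ[ℝ] ((LieAlgebra.ad ℝ L (h r)) ^ k) x))
        = (k.factorial : ℝ)⁻¹ • (((k : ℝ) • (MvPolynomial.X r ^ (k - 1) * q)) ⊗ₜ[ℝ]
            ((LieAlgebra.ad ℝ L (h r)) ^ k) x)
          + (k.factorial : ℝ)⁻¹ • ((MvPolynomial.X r ^ k * MvPolynomial.pderiv r q) ⊗ₜ[ℝ]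
            ((LieAlgebra.ad ℝ L (h r)) ^ k) x) := by
      intro k _
      rw [map_smul, timeDeriv_tmul, Derivation.leibniz, Derivation.leibniz_pow,
        MvPolynomial.pderiv_X_self, add_comm, TensorProduct.add_tmul, smul_add]
      congr 3
      simp only [smul_eq_mul, mul_one, nsmul_eq_mul, MvPolynomial.smul_eq_C_mul,
        map_natCast]
      ring
    rw [Finset.sum_congr rfl hk, Finset.sum_add_distrib]
    congr 1
    rcases K with _ | K
    · simp
    · rw [Finset.sum_range_succ', Finset.sum_range_succ _ K, hr]
      simp only [Nat.cast_zero, zero_smul, TensorProduct.zero_tmul, smul_zero, add_zero,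
        LinearMap.zero_apply, TensorProduct.tmul_zero, Nat.add_sub_cancel]
      refine Finset.sum_congr rfl fun k _ => ?_
      rw [TensorProduct.smul_tmul', smul_smul, ← TensorProduct.smul_tmul', Nat.factorial_succ]
      congr 1
      push_cast
      field_simp

variable (K h)

/-- The composition of the flows with indices in a list, the first index acting first. -/
def flows (l : List (Fin n)) (u : TimePoly n L) : TimePoly n L :=
  l.foldl (fun u r => flow K h r u) u

variable {K h}

theorem flows_cons (r : Fin n) (l : List (Fin n)) (u : TimePoly n L) :
    flows K h (r :: l) u = flows K h l (flow K h r u) := rfl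

theorem flows_lie {l : List (Fin n)} (hl : ∀ r ∈ l, (LieAlgebra.ad ℝ L (h r)) ^ K = 0)
    (u v : TimePoly n L) : flows K h l ⁅u, v⁆ = ⁅flows K h l u, flows K h l v⁆ := by
  induction l generalizing u v with
  | nil => rfl
  | cons r l ih =>
    rw [flows_cons, flow_lie (hl r (by simp)), ih fun r hr => hl r (by simp [hr])]
    rfl

theorem flows_zero (l : List (Fin n)) : flows K h l 0 = 0 := by
  induction l with
  | nil => rfl
  | cons r l ih => rw [flows_cons, map_zero, ih]

theorem flows_add (l : List (Fin n)) (u v : TimePoly n L) :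
    flows K h l (u + v) = flows K h l u + flows K h l v := by
  induction l generalizing u v with
  | nil => rfl
  | cons r l ih => rw [flows_cons, map_add, ih, flows_cons, flows_cons]

theorem flows_smul (l : List (Fin n)) (c : ℝ) (u : TimePoly n L) :
    flows K h l (c • u) = c • flows K h l u := by
  induction l generalizing u with
  | nil => rfl
  | cons r l ih => rw [flows_cons, map_smul, ih, flows_cons]

theorem flows_sum {ι : Type*} (l : List (Fin n)) (s : Finset ι) (u : ι → TimePoly n L) :
    flows K h l (∑ k ∈ s, u k) = ∑ k ∈ s, flows K h l (u k) :=
  map_sum (AddMonoidHom.mk ⟨flows K h l, flows_zero l⟩ (flows_add l)) u s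

theorem timeDeriv_flows_of_notMem {l : List (Fin n)} {j : Fin n} (hj : j ∉ l)
    (u : TimePoly n L) : timeDeriv j (flows K h l u) = flows K h l (timeDeriv j u) := by
  induction l generalizing u with
  | nil => rfl
  | cons r l ih =>
    rw [List.mem_cons, not_or] at hj
    rw [flows_cons, ih hj.2, timeDeriv_flow_of_ne hj.1, flows_cons]

/-- Differentiation inserts `h_j` just after the flow of `j`; the later flows are Lie automorphisms
and distribute over the bracket. As the list increases, they are those with index greater than `j`.
-/
theorem timeDeriv_flows {l : List (Fin n)} (hl : ∀ r ∈ l, (LieAlgebra.ad ℝ L (h r)) ^ K = 0)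
    (hs : l.Pairwise (· < ·)) {j : Fin n} (hj : j ∈ l) {u : TimePoly n L}
    (hu : timeDeriv j u = 0) :
    timeDeriv j (flows K h l u)
      = ⁅flows K h (l.filter (j < ·)) (1 ⊗ₜ h j), flows K h l u⁆ := by
  induction l generalizing u with
  | nil => simp at hj
  | cons r l ih =>
    rw [List.pairwise_cons] at hs
    have hl' : ∀ r ∈ l, (LieAlgebra.ad ℝ L (h r)) ^ K = 0 := fun r hr => hl r (by simp [hr])
    rcases List.mem_cons.mp hj with rfl | hj'
    · have hf : (j :: l).filter (j < ·) = l := by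
        rw [List.filter_cons_of_neg (by simp), List.filter_eq_self]
        exact fun a ha => by simpa using hs.1 a ha
      rw [hf, flows_cons, timeDeriv_flows_of_notMem fun hj' => (hs.1 j hj').false,
        timeDeriv_flow (hl j (by simp)), hu, map_zero, add_zero, flows_lie hl']
    · have hrj := hs.1 j hj'
      rw [List.filter_cons_of_neg (by simpa using hrj.le), flows_cons]
      exact ih hl' hs.2 hj' (by rw [timeDeriv_flow_of_ne hrj.ne', hu, map_zero])

theorem foldl_ad_pow_zero (s : Fin n →₀ ℕ) (l : List (Fin n)) :
    l.foldl (fun y r => ((LieAlgebra.ad ℝ L (h r)) ^ s r) y) 0 = 0 := by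
  induction l with
  | nil => rfl
  | cons r l ih => rw [List.foldl_cons, map_zero, ih]

/-- No index of `l` occurs in the initial monomial or twice in `l`, so the power of `t_r` must come
entirely from the flow of `r`, which selects the term of order `s r` in its series. -/
theorem tcoeff_flows {l : List (Fin n)} (hl : ∀ r ∈ l, (LieAlgebra.ad ℝ L (h r)) ^ K = 0)
    (hnd : l.Nodup) (s m : Fin n →₀ ℕ) (hm : ∀ r ∈ l, m r = 0) (x : L) :
    tcoeff s (flows K h l (MvPolynomial.monomial m 1 ⊗ₜ x))
      = if ∀ j, j ∉ l → s j = m j then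
          (l.map fun r => ((s r).factorial : ℝ)⁻¹).prod •
            l.foldl (fun y r => ((LieAlgebra.ad ℝ L (h r)) ^ s r) y) x
        else 0 := by
  classical
  induction l generalizing m x with
  | nil =>
    simp only [flows, List.foldl_nil, tcoeff_tmul, MvPolynomial.coeff_monomial, List.map_nil,
      List.prod_nil, one_smul, List.not_mem_nil, not_false_eq_true, forall_true_left,
      ite_smul, zero_smul]
    refine if_congr ?_ rfl rfl
    rw [eq_comm, Finsupp.ext_iff]
  | cons r l ih =>
    rw [List.nodup_cons] at hnd
    have hl' : ∀ r ∈ l, (LieAlgebra.ad ℝ L (h r)) ^ K = 0 := fun r hr => hl r (by simp [hr])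
    have hmr : m r = 0 := hm r (by simp)
    have hterm : ∀ k, MvPolynomial.X r ^ k * MvPolynomial.monomial m (1 : ℝ)
        = MvPolynomial.monomial (m + Finsupp.single r k) 1 := fun k => by
      rw [MvPolynomial.X_pow_eq_monomial, MvPolynomial.monomial_mul, one_mul, add_comm]
    have hih : ∀ k, tcoeff s (flows K h l (MvPolynomial.monomial (m + Finsupp.single r k) 1 ⊗ₜ
        ((LieAlgebra.ad ℝ L (h r)) ^ k) x)) = _ := fun k =>
      ih hl' hnd.2 (m + Finsupp.single r k) (fun a ha => by
        have har : r ≠ a := fun e => hnd.1 (e ▸ ha)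
        simp [hm a (by simp [ha]), har]) _
    have hcond : ∀ k, (∀ j, j ∉ l → s j = (m + Finsupp.single r k) j)
        ↔ s r = k ∧ ∀ j, j ∉ r :: l → s j = m j := by
      intro k
      constructor
      · intro H
        refine ⟨by simpa [hmr] using H r hnd.1, fun j hj => ?_⟩
        rw [List.mem_cons, not_or] at hj
        simpa [Ne.symm hj.1] using H j hj.2
      · rintro ⟨rfl, H⟩ j hj
        by_cases hjr : j = r
        · subst hjr
          simp [hmr]
        · rw [H j (by simp [hjr, hj])]
          simp [Ne.symm hjr]
    rw [flows_cons, flow_tmul, flows_sum, map_sum]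
    simp only [hterm, flows_smul, map_smul, hih, hcond]
    by_cases H : ∀ j, j ∉ r :: l → s j = m j
    · rw [if_pos H]
      by_cases hsK : s r < K
      · rw [Finset.sum_eq_single (s r)]
        · rw [if_pos ⟨rfl, H⟩, smul_smul, List.map_cons, List.prod_cons, List.foldl_cons]
        · intro k _ hk
          rw [if_neg fun H' => hk H'.1.symm, smul_zero]
        · exact fun hk => absurd (Finset.mem_range.mpr hsK) hk
      -- If `s r` exceeds the truncation order, the formula persists because that power of `ad h_r`
      -- vanishes.
      · rw [Finset.sum_eq_zero, List.foldl_cons, pow_eq_zero_of_le (not_lt.mp hsK)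
          (hl r (by simp)), LinearMap.zero_apply, foldl_ad_pow_zero, smul_zero]
        intro k hk
        rw [if_neg, smul_zero]
        rintro ⟨rfl, -⟩
        exact hsK (Finset.mem_range.mp hk)
    · rw [if_neg H]
      exact Finset.sum_eq_zero fun k _ => by rw [if_neg fun H' => H H'.2, smul_zero]

end Flows

/-! ### The product of exponentials as a sum over monotone multi-indices -/

section Expansion

variable {n : ℕ} {L : Type*} [LieRing L] [LieAlgebra ℝ L]

/-- The exponent of the monomial `t_{r_1} ⋯ t_{r_k}`. -/
def timesExponent {k : ℕ} (r : Fin k → Fin n) : Fin n →₀ ℕ :=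
  ∑ a, Finsupp.single (r a) 1

theorem prod_X_eq_monomial {k : ℕ} (r : Fin k → Fin n) :
    (∏ a, (MvPolynomial.X (r a) : MvPolynomial (Fin n) ℝ))
      = MvPolynomial.monomial (timesExponent r) 1 := by
  rw [timesExponent, MvPolynomial.monomial_sum_one]
  rfl

theorem timesExponent_apply {k : ℕ} (r : Fin k → Fin n) (j : Fin n) :
    timesExponent r j = (List.ofFn r).count j := by
  classical
  induction k with
  | zero => simp [timesExponent]
  | succ k ih =>
    have h1 : timesExponent r = Finsupp.single (r 0) 1 + timesExponent fun a => r a.succ := by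
      rw [timesExponent, Fin.sum_univ_succ, timesExponent]
    rw [h1, Finsupp.add_apply, ih, List.ofFn_succ, List.count_cons, add_comm,
      Finsupp.single_apply]
    simp

/-- The increasing list in which `j` occurs `s j` times. -/
def sortedList (s : Fin n →₀ ℕ) : List (Fin n) :=
  (List.finRange n).flatMap fun j => List.replicate (s j) j

theorem count_sortedList (s : Fin n →₀ ℕ) (j : Fin n) : (sortedList s).count j = s j := by
  rw [sortedList, List.count_flatMap]
  have : (List.map (List.count j ∘ fun j => List.replicate (s j) j) (List.finRange n))
      = (List.finRange n).map fun a => if a = j then s a else 0 :=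
    List.map_congr_left fun a _ => by simp [List.count_replicate]
  rw [this, ← List.ofFn_eq_map, List.sum_ofFn]
  simp

theorem pairwise_sortedList (s : Fin n →₀ ℕ) : (sortedList s).Pairwise (· ≤ ·) := by
  rw [sortedList, List.pairwise_flatMap]
  refine ⟨fun a _ => List.pairwise_replicate.mpr (Or.inr le_rfl), ?_⟩
  refine (List.pairwise_lt_finRange n).imp fun {a b} hab x hx y hy => ?_
  rw [List.eq_of_mem_replicate hx, List.eq_of_mem_replicate hy]
  exact hab.le

theorem ofFn_eq_sortedList {k : ℕ} {r : Fin k → Fin n} (hr : Monotone r) :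
    List.ofFn r = sortedList (timesExponent r) := by
  classical
  refine List.Perm.eq_of_pairwise (le := (· ≤ ·)) (fun a b _ _ h1 h2 => le_antisymm h1 h2)
    ?_ (pairwise_sortedList _) (List.perm_iff_count.mpr fun j => ?_)
  · exact List.pairwise_ofFn.mpr fun a b hab => hr hab.le
  · rw [count_sortedList, timesExponent_apply]

theorem tcoeff_summand {k : ℕ} (s : Fin n →₀ ℕ) (r : Fin k → Fin n) (c : ℝ) (x : L) :
    tcoeff s (c • ((∏ a, (MvPolynomial.X (r a) : MvPolynomial (Fin n) ℝ)) ⊗ₜ[ℝ] x))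
      = if timesExponent r = s then c • x else 0 := by
  classical
  rw [map_smul, tcoeff_tmul, prod_X_eq_monomial, MvPolynomial.coeff_monomial, ite_smul, one_smul,
    zero_smul, smul_ite, smul_zero]

/-- A monotone multi-index, including its length, is recovered from its monomial by sorting, so a
single summand contributes. -/
theorem tcoeff_adExpansion (h : Fin n → L) (α : (k : ℕ) → Fin n → (Fin k → Fin n) → ℝ) {N : ℕ}
    (i : Fin n) {k : ℕ} (hk : k ≤ N) {r : Fin k → Fin n} (hr : Monotone r)
    (hir : ∀ a, i < r a) :
    tcoeff (timesExponent r) (adExpansion h α N i)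
      = ((-1 : ℝ) ^ k * (if k ≤ 1 then 1 else α k i r)) • nestedAd h i r := by
  classical
  rw [adExpansion, map_sum, Finset.sum_eq_single k]
  · rw [map_sum, Finset.sum_eq_single r]
    · rw [tcoeff_summand, if_pos rfl]
    · intro r' hr' hne
      rw [tcoeff_summand, if_neg]
      intro he
      refine hne (List.ofFn_injective ?_)
      rw [ofFn_eq_sortedList (Finset.mem_filter.mp hr').2.1, he, ofFn_eq_sortedList hr]
    · exact fun hn => absurd (Finset.mem_filter.mpr ⟨Finset.mem_univ _, hr, hir⟩) hn
  · intro k' _ hne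
    rw [map_sum]
    refine Finset.sum_eq_zero fun r' hr' => ?_
    rw [tcoeff_summand, if_neg]
    intro he
    have := congrArg List.length ((ofFn_eq_sortedList (Finset.mem_filter.mp hr').2.1).trans
      (he ▸ (ofFn_eq_sortedList hr).symm))
    simp only [List.length_ofFn] at this
    exact hne this
  · exact fun hn => absurd (Finset.mem_range.mpr (Nat.lt_succ_of_le hk)) hn

theorem timesExponent_eq_zero_of_le {k : ℕ} {r : Fin k → Fin n} {i j : Fin n}
    (hir : ∀ a, i < r a) (hj : j ≤ i) : timesExponent r j = 0 := by
  rw [timesExponent_apply, List.count_eq_zero]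
  intro hmem
  obtain ⟨a, rfl⟩ := (List.mem_ofFn' _ _).mp hmem
  exact absurd (hir a) (not_lt.mpr hj)

theorem tcoeff_adExpansion_of_ne (h : Fin n → L) (α : (k : ℕ) → Fin n → (Fin k → Fin n) → ℝ)
    (N : ℕ) (i : Fin n) {s : Fin n →₀ ℕ} {j : Fin n} (hj : j ≤ i) (hs : s j ≠ 0) :
    tcoeff s (adExpansion h α N i) = 0 := by
  classical
  rw [adExpansion, map_sum]
  refine Finset.sum_eq_zero fun k _ => ?_
  rw [map_sum]
  refine Finset.sum_eq_zero fun r hr => ?_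
  rw [tcoeff_summand, if_neg]
  rintro rfl
  exact hs (timesExponent_eq_zero_of_le (Finset.mem_filter.mp hr).2.2 hj)

theorem exists_timesExponent_eq {s : Fin n →₀ ℕ} {i : Fin n} (hs : ∀ j ≤ i, s j = 0) :
    ∃ (k : ℕ) (r : Fin k → Fin n), Monotone r ∧ (∀ a, i < r a) ∧ timesExponent r = s := by
  refine ⟨(sortedList s).length, (sortedList s).get, ?_, ?_, ?_⟩
  · exact (List.sortedLE_iff_pairwise.mpr (pairwise_sortedList s)).monotone_get
  · intro a
    by_contra ha
    have h1 := List.count_pos_iff.mpr (List.get_mem (sortedList s) a)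
    rw [count_sortedList, hs _ (not_lt.mp ha)] at h1
    exact h1.false
  · ext j
    rw [timesExponent_apply, List.ofFn_get, count_sortedList]

/-- Each bracket `⁅y, h r⁆` is minus the usual adjoint action; this is the origin of the signs
`(-1)^k`. Indices up to `i` have multiplicity zero and drop out. -/
theorem foldl_lie_sortedList (h : Fin n → L) {s : Fin n →₀ ℕ} {i : Fin n}
    (hs : ∀ j ≤ i, s j = 0) (x : L) :
    (sortedList s).foldl (fun y r => ⁅y, h r⁆) x
      = (-1 : ℝ) ^ (sortedList s).length • ((List.finRange n).filter (i < ·)).foldl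
        (fun y r => ((LieAlgebra.ad ℝ L (h r)) ^ s r) y) x := by
  have h1 : ∀ (k : ℕ) (j : Fin n) (y : L), (List.replicate k j).foldl (fun y r => ⁅y, h r⁆) y
      = (-1 : ℝ) ^ k • ((LieAlgebra.ad ℝ L (h j)) ^ k) y := by
    intro k j
    induction k with
    | zero => simp
    | succ k ih =>
      intro y
      rw [List.replicate_succ, List.foldl_cons, ih, pow_succ (LieAlgebra.ad ℝ L (h j)),
        Module.End.mul_apply, LieAlgebra.ad_apply, ← lie_skew y, map_neg, pow_succ, mul_neg_one,
        neg_smul, smul_neg]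
  have h2 : ∀ (l : List (Fin n)) (c : ℝ) (y : L),
      l.foldl (fun y r => ((LieAlgebra.ad ℝ L (h r)) ^ s r) y) (c • y)
        = c • l.foldl (fun y r => ((LieAlgebra.ad ℝ L (h r)) ^ s r) y) y := by
    intro l c
    induction l with
    | nil => exact fun _ => rfl
    | cons r l ih =>
      intro y
      rw [List.foldl_cons, map_smul, ih, List.foldl_cons]
  rw [sortedList]
  generalize List.finRange n = l
  induction l generalizing x with
  | nil => simp
  | cons r l ih =>
    rw [List.flatMap_cons, List.foldl_append, ih, h1, h2, smul_smul, List.length_append, pow_add,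
      List.length_replicate, mul_comm]
    congr 1
    by_cases hr : i < r
    · rw [List.filter_cons_of_pos (by simpa using hr), List.foldl_cons]
    · rw [List.filter_cons_of_neg (by simpa using hr), hs r (not_lt.mp hr)]
      simp

variable (n) in
/-- The coefficients `1 / ∏_j (s_j)!`, where `s_j` is the multiplicity of `j` in the multi-index,
of the expansion of a product of exponentials. -/
def expCoeff (k : ℕ) (_ : Fin n) (r : Fin k → Fin n) : ℝ :=
  ∏ j, ((timesExponent r j).factorial : ℝ)⁻¹

theorem expCoeff_of_le_one {k : ℕ} (hk : k ≤ 1) (i : Fin n) (r : Fin k → Fin n) :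
    expCoeff n k i r = 1 := by
  refine Finset.prod_eq_one fun j _ => ?_
  have : timesExponent r j ≤ 1 := by
    rw [timesExponent_apply]
    exact List.count_le_length.trans (by simpa using hk)
  rw [Nat.factorial_eq_one.mpr this, Nat.cast_one, inv_one]

theorem adExpansion_expCoeff {K : ℕ} {h : Fin n → L} {i : Fin n}
    (hK : ∀ r, i < r → (LieAlgebra.ad ℝ L (h r)) ^ K = 0) {N : ℕ}
    (hN : ∀ (k : ℕ) (r : Fin k → Fin n), N < k → (∀ a, i < r a) → nestedAd h i r = 0) :
    adExpansion h (expCoeff n) N i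
      = flows K h ((List.finRange n).filter (i < ·)) (1 ⊗ₜ h i) := by
  refine TimePoly.ext_tcoeff fun s => ?_
  have hl : ∀ j, j ∈ (List.finRange n).filter (i < ·) ↔ i < j := fun j => by simp
  have hone : (1 : MvPolynomial (Fin n) ℝ) = MvPolynomial.monomial 0 1 := rfl
  rw [hone, tcoeff_flows (fun r hr => hK r ((hl r).mp hr)) ((List.nodup_finRange n).filter _) s 0
    (fun _ _ => rfl)]
  simp only [hl, not_lt, Finsupp.coe_zero, Pi.zero_apply]
  by_cases hs : ∀ j ≤ i, s j = 0
  · rw [if_pos hs]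
    obtain ⟨k, r, hr, hir, rfl⟩ := exists_timesExponent_eq hs
    have hlen : (sortedList (timesExponent r)).length = k := by
      rw [← ofFn_eq_sortedList hr, List.length_ofFn]
    have hnest : nestedAd h i r = (-1 : ℝ) ^ k • ((List.finRange n).filter (i < ·)).foldl
        (fun y j => ((LieAlgebra.ad ℝ L (h j)) ^ timesExponent r j) y) (h i) := by
      rw [nestedAd, ofFn_eq_sortedList hr, foldl_lie_sortedList h hs, hlen]
    have hsign : ((-1 : ℝ) ^ k * (-1) ^ k) = 1 := by
      rw [← mul_pow]
      simp
    have hprod : (((List.finRange n).filter (i < ·)).map fun j =>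
        ((timesExponent r j).factorial : ℝ)⁻¹).prod = expCoeff n k i r := by
      rw [expCoeff, ← List.prod_ofFn, List.ofFn_eq_map]
      have hle : ∀ j, ¬ i < j → ((timesExponent r j).factorial : ℝ)⁻¹ = 1 := fun j hj => by
        rw [hs j (not_lt.mp hj)]
        simp
      generalize List.finRange n = l
      induction l with
      | nil => rfl
      | cons j l ih =>
        by_cases hj : i < j
        · rw [List.filter_cons_of_pos (by simpa using hj), List.map_cons, List.prod_cons, ih,
            List.map_cons, List.prod_cons]
        · rw [List.filter_cons_of_neg (by simpa using hj), ih, List.map_cons, List.prod_cons,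
            hle j hj, one_mul]
    by_cases hkN : k ≤ N
    · rw [tcoeff_adExpansion h _ i hkN hr hir, hprod, hnest, smul_smul]
      congr 1
      split_ifs with hk1
      · rw [expCoeff_of_le_one hk1, mul_one, hsign]
      · rw [mul_right_comm, hsign, one_mul]
    -- Beyond the truncation order both coefficients vanish: the nested bracket is zero, and every
    -- summand has a monomial of degree at most `N`.
    · have h0 := hN k r (not_le.mp hkN) hir
      have h0' : ((List.finRange n).filter (i < ·)).foldl
          (fun y j => ((LieAlgebra.ad ℝ L (h j)) ^ timesExponent r j) y) (h i) = 0 := by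
        rw [hnest] at h0
        exact (smul_eq_zero.mp h0).resolve_left (by simp)
      rw [h0', smul_zero, adExpansion, map_sum]
      classical
      refine Finset.sum_eq_zero fun k' hk' => ?_
      rw [map_sum]
      refine Finset.sum_eq_zero fun r' hr' => ?_
      rw [tcoeff_summand, if_neg]
      intro he
      have hlen' : (sortedList (timesExponent r')).length = k' := by
        rw [← ofFn_eq_sortedList (Finset.mem_filter.mp hr').2.1, List.length_ofFn]
      rw [he, hlen] at hlen'
      rw [Finset.mem_range] at hk'
      omega
  · rw [if_neg hs]
    push Not at hs
    obtain ⟨j, hj, hsj⟩ := hs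
    exact tcoeff_adExpansion_of_ne h _ N i hj hsj

end Expansion

/-! ### Vanishing of nested brackets -/

section NestedAd

variable {n : ℕ} {L : Type*} [LieRing L]

theorem nestedAd_fin_zero (h : Fin n → L) (i : Fin n) (r : Fin 0 → Fin n) :
    nestedAd h i r = h i := rfl

theorem nestedAd_succ (h : Fin n → L) (i : Fin n) {k : ℕ} (r : Fin (k + 1) → Fin n) :
    nestedAd h i r = (List.ofFn fun a => r (Fin.succ a)).foldl (fun x s => ⁅x, h s⁆)
      ⁅h i, h (r 0)⁆ := by
  rw [nestedAd, List.ofFn_succ, List.foldl_cons]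

theorem foldl_lie_zero (h : Fin n → L) (l : List (Fin n)) :
    l.foldl (fun x s => ⁅x, h s⁆) 0 = 0 := by
  induction l with
  | nil => rfl
  | cons r l ih => rw [List.foldl_cons, zero_lie, ih]

theorem foldl_lie_eq_zero_of_mem {h : Fin n → L} {l : List (Fin n)} {r : Fin n} (hr : r ∈ l)
    (hc : ∀ y : L, ⁅y, h r⁆ = 0) (x : L) : l.foldl (fun x s => ⁅x, h s⁆) x = 0 := by
  induction l generalizing x with
  | nil => simp at hr
  | cons a l ih =>
    rw [List.foldl_cons]
    rcases List.mem_cons.mp hr with rfl | hr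
    · rw [hc, foldl_lie_zero]
    · exact ih hr _

theorem nestedAd_eq_zero_of_lie_eq_zero {h : Fin n → L} {i : Fin n}
    (hc : ∀ j, i < j → ⁅h i, h j⁆ = 0) {k : ℕ} (hk : 1 ≤ k) {r : Fin k → Fin n}
    (hr : ∀ a, i < r a) : nestedAd h i r = 0 := by
  obtain ⟨k, rfl⟩ := Nat.exists_eq_add_of_le' hk
  rw [nestedAd_succ, hc _ (hr 0), foldl_lie_zero]

end NestedAd

section Expansion

variable {n : ℕ} {L : Type*} [LieRing L] [LieAlgebra ℝ L]

theorem timeDeriv_adExpansion (h : Fin n → L) (α : (k : ℕ) → Fin n → (Fin k → Fin n) → ℝ)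
    (N : ℕ) {i j : Fin n} (hij : i ≤ j) : timeDeriv i (adExpansion h α N j) = 0 := by
  refine TimePoly.ext_tcoeff fun s => ?_
  rw [tcoeff_timeDeriv, tcoeff_adExpansion_of_ne h α N j hij (by simp), smul_zero, map_zero]

theorem atZero_adExpansion (h : Fin n → L) (α : (k : ℕ) → Fin n → (Fin k → Fin n) → ℝ) (N : ℕ)
    (i : Fin n) : atZero (adExpansion h α N i) = h i := by
  have := tcoeff_adExpansion h α i (Nat.zero_le N) (r := Fin.elim0) (fun a => a.elim0)
    (fun a => a.elim0)
  rw [nestedAd_fin_zero] at this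
  rw [atZero_eq_tcoeff]
  simpa [timesExponent] using this

theorem adExpansion_eq_of_lie_eq_zero {h : Fin n → L} {i : Fin n}
    (hc : ∀ j, i < j → ⁅h i, h j⁆ = 0) (α : (k : ℕ) → Fin n → (Fin k → Fin n) → ℝ) (N : ℕ) :
    adExpansion h α N i = 1 ⊗ₜ h i := by
  classical
  rw [adExpansion, Finset.sum_range_succ', Finset.sum_eq_zero fun k _ =>
    Finset.sum_eq_zero fun r hr => by
      rw [nestedAd_eq_zero_of_lie_eq_zero hc (Nat.le_add_left 1 k) (Finset.mem_filter.mp hr).2.2,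
        TensorProduct.tmul_zero, smul_zero]]
  rw [zero_add, Finset.sum_eq_single Fin.elim0]
  · simp [nestedAd_fin_zero]
  · exact fun r _ hr => absurd (Subsingleton.elim _ _) hr
  · intro hn
    exact absurd (Finset.mem_filter.mpr ⟨Finset.mem_univ _, fun a => a.elim0, fun a => a.elim0⟩) hn

theorem lie_one_tmul_eq_zero {y : L} (hc : ∀ x : L, ⁅x, y⁆ = 0) (u : TimePoly n L) :
    ⁅u, (1 ⊗ₜ y : TimePoly n L)⁆ = 0 := by
  induction u using TensorProduct.induction_on with
  | zero => exact TimePoly.zero_lie _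
  | add u v hu hv => rw [TimePoly.add_lie, hu, hv, add_zero]
  | tmul q x => rw [LieAlgebra.ExtendScalars.bracket_tmul, hc, TensorProduct.tmul_zero]

theorem frobeniusCondition_of_timeDeriv {H : Fin n → TimePoly n L}
    (h0 : ∀ i j, i ≤ j → timeDeriv i (H j) = 0)
    (h1 : ∀ i j, i < j → timeDeriv j (H i) = ⁅H j, H i⁆) : FrobeniusCondition H := by
  intro i j
  rcases lt_trichotomy i j with hij | rfl | hij
  · rw [h0 i j hij.le, h1 i j hij, sub_zero, ← TimePoly.lie_skew (H i), neg_add_cancel]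
  · rw [sub_self, zero_add]
    exact lie_self (H i)
  · rw [h0 j i hij.le, h1 j i hij, zero_sub, neg_add_cancel]

end Expansion

/-! ### The deformation of the quasi-Stäckel algebra -/

section Deformation

variable {n ε : ℕ} {L : Type*} [LieRing L] [LieAlgebra ℝ L] {b : Module.Basis (Fin n) ℝ L}

/-- The span of the basis vectors with index at least `t`. -/
def tailSpan (b : Module.Basis (Fin n) ℝ L) (t : ℕ) : Submodule ℝ L :=
  Submodule.span ℝ (b '' {q | t ≤ q.val})

theorem tailSpan_eq_bot {t : ℕ} (ht : n ≤ t) : tailSpan b t = ⊥ := by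
  rw [tailSpan, Submodule.span_eq_bot]
  rintro _ ⟨q, hq, rfl⟩
  have hq' : t ≤ q.val := hq
  have := q.isLt
  omega

/-- For `r ≥ 2` the index rises from `q` to `r + q + ε - 1 ≥ q + 1`. For `r = 1` and `ε = 0` it
stays at `q`, so `ad h_1` is diagonal and in general not nilpotent; this is why index `0` is set
apart below. -/
theorem HasQsConst.lie_mem_tailSpan (hb : HasQsConst ε b) {r : Fin n} (hr : 2 ≤ r.val) {t : ℕ}
    {x : L} (hx : x ∈ tailSpan b t) : ⁅b r, x⁆ ∈ tailSpan b (t + 1) := by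
  induction hx using Submodule.span_induction with
  | mem x hx =>
    obtain ⟨q, hq, rfl⟩ := hx
    have hq' : t ≤ q.val := hq
    by_cases h : q.val = 0 ∨ n < r.val + q + ε
    · rw [hb.lie_eq_zero (by tauto)]
      exact Submodule.zero_mem _
    · push Not at h
      rw [hb.lie_eq (q := ⟨r.val + q + ε - 1, by omega⟩) (by omega) (by omega)
        (by simp only; omega)]
      refine Submodule.smul_mem _ _ (Submodule.subset_span ⟨_, ?_, rfl⟩)
      rw [Set.mem_ofPred_eq]
      simp only
      omega
  | zero =>
    rw [lie_zero]
    exact Submodule.zero_mem _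
  | add x y _ _ hx hy =>
    rw [lie_add]
    exact Submodule.add_mem _ hx hy
  | smul c x _ hx =>
    rw [lie_smul]
    exact Submodule.smul_mem _ _ hx

theorem HasQsConst.ad_pow_eq_zero (hb : HasQsConst ε b) {r : Fin n} (hr : 2 ≤ r.val) :
    (LieAlgebra.ad ℝ L (b r)) ^ n = 0 := by
  have key : ∀ (k : ℕ) (x : L), ((LieAlgebra.ad ℝ L (b r)) ^ k) x ∈ tailSpan b k := by
    intro k x
    induction k with
    | zero =>
      have h0 : {q : Fin n | 0 ≤ q.val} = Set.univ := Set.eq_univ_of_forall fun q => Nat.zero_le _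
      rw [tailSpan, h0, Set.image_univ, b.span_eq]
      trivial
    | succ k ih =>
      rw [pow_succ', Module.End.mul_apply, LieAlgebra.ad_apply]
      exact hb.lie_mem_tailSpan hr ih
  ext x
  have := key n x
  rw [tailSpan_eq_bot le_rfl] at this
  simpa using this

theorem HasQsConst.lie_zero_eq_zero (hb : HasQsConst ε b) {i : Fin n} (hi : i.val = 0) (x : L) :
    ⁅x, b i⁆ = 0 := by
  rw [← b.sum_repr x, sum_lie]
  refine Finset.sum_eq_zero fun a _ => ?_
  rw [smul_lie, hb.lie_eq_zero (by tauto), smul_zero]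

theorem HasQsConst.nestedAd_eq_zero (hb : HasQsConst ε b) {k : ℕ} (hk : n < k) {i : Fin n}
    {r : Fin k → Fin n} (hr : ∀ a, i < r a) : nestedAd b i r = 0 := by
  by_cases hi : i.val = 0
  · exact nestedAd_eq_zero_of_lie_eq_zero (fun j _ => hb.lie_eq_zero (Or.inl hi)) (by omega) hr
  · have key : ∀ (l : List (Fin n)) (t : ℕ) (x : L), (∀ s ∈ l, 2 ≤ s.val) → x ∈ tailSpan b t →
        l.foldl (fun x s => ⁅x, b s⁆) x ∈ tailSpan b (t + l.length) := by
      intro l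
      induction l with
      | nil => exact fun _ _ _ hx => hx
      | cons s l ih =>
        intro t x hl hx
        rw [List.foldl_cons, List.length_cons, ← add_assoc, add_right_comm]
        refine ih _ _ (fun s hs => hl s (by simp [hs])) ?_
        rw [← lie_skew]
        exact Submodule.neg_mem _ (hb.lie_mem_tailSpan (hl s (by simp)) hx)
    have h1 := key (List.ofFn r) i.val (b i) (fun s hs => by
      obtain ⟨a, rfl⟩ := (List.mem_ofFn' _ _).mp hs
      have := Fin.lt_def.mp (hr a)
      omega) (Submodule.subset_span ⟨i, (show i.val ≤ i.val from le_rfl), rfl⟩)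
    rw [tailSpan_eq_bot (by rw [List.length_ofFn]; omega)] at h1
    exact (Submodule.mem_bot ℝ).mp h1

theorem HasQsConst.adExpansion_eq_flows (hb : HasQsConst ε b) {i : Fin n} (hi : 1 ≤ i.val)
    {N : ℕ} (hN : n ≤ N) : adExpansion b (expCoeff n) N i
      = flows n b ((List.finRange n).filter (i < ·)) (1 ⊗ₜ b i) :=
  adExpansion_expCoeff (fun r hr => hb.ad_pow_eq_zero (by have := Fin.lt_def.mp hr; omega))
    fun _ _ hk hr => hb.nestedAd_eq_zero (hN.trans_lt hk) hr

theorem HasQsConst.adExpansion_zero (hb : HasQsConst ε b) {i : Fin n} (hi : i.val = 0)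
    (α : (k : ℕ) → Fin n → (Fin k → Fin n) → ℝ) (N : ℕ) :
    adExpansion b α N i = 1 ⊗ₜ b i :=
  adExpansion_eq_of_lie_eq_zero (fun _ _ => hb.lie_eq_zero (Or.inl hi)) α N

/-- Every truncation of order at least `n` equals the same product of flows. -/
theorem HasQsConst.adExpansion_congr (hb : HasQsConst ε b) {N : ℕ} (hN : n ≤ N) :
    adExpansion b (expCoeff n) n = adExpansion b (expCoeff n) N := by
  funext i
  by_cases hi : i.val = 0
  · rw [hb.adExpansion_zero hi, hb.adExpansion_zero hi]
  · rw [hb.adExpansion_eq_flows (by omega) le_rfl, hb.adExpansion_eq_flows (by omega) hN]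

theorem HasQsConst.frobeniusCondition (hb : HasQsConst ε b) :
    FrobeniusCondition (adExpansion b (expCoeff n) n) := by
  refine frobeniusCondition_of_timeDeriv (fun i j hij => timeDeriv_adExpansion _ _ _ hij)
    fun i j hij => ?_
  by_cases hi : i.val = 0
  · rw [hb.adExpansion_zero hi, lie_one_tmul_eq_zero (hb.lie_zero_eq_zero hi)]
    simp
  · have hij' := Fin.lt_def.mp hij
    rw [hb.adExpansion_eq_flows (by omega) le_rfl, hb.adExpansion_eq_flows (by omega) le_rfl,
      timeDeriv_flows (j := j) ?_ ((List.pairwise_lt_finRange n).filter _) (by simpa using hij)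
        (by simp)]
    · congr 2
      rw [List.filter_filter]
      refine List.filter_congr fun a _ => ?_
      simp only [← Bool.decide_and, decide_eq_decide]
      exact ⟨fun h => h.1, fun h => ⟨h, hij.trans h⟩⟩
    · intro r hr
      have := Fin.lt_def.mp (by simpa using hr : i < r)
      exact hb.ad_pow_eq_zero (by omega)

theorem HasQsConst.isMultiTimeDeformation (hb : HasQsConst ε b) (hε : ε = 0 ∨ ε = 1)
    (hn : 2 ≤ n) : IsMultiTimeDeformation (b.reindex (reorder n).symm) (centerDim n (n + ε))
      ((n + ε) / 2 + 1)
      (toOriginalOrder (reorder n).symm (adExpansion b (expCoeff n) n)) := by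
  have hb' : ∀ i, b.reindex (reorder n).symm i = b (reorder n i) := fun i => by simp
  refine ⟨fun i => ?_, hb.frobeniusCondition.toOriginalOrder _, fun i hi => ?_, fun i _ => ?_⟩
  · classical
    rw [toOriginalOrder_apply, Equiv.symm_symm, adExpansion, map_sum]
    refine Submodule.sum_mem _ fun k _ => ?_
    rw [map_sum]
    refine Submodule.sum_mem _ fun r hr => ?_
    rw [map_smul, renameTimes_tmul, map_prod]
    refine Submodule.smul_mem _ _ ?_
    -- A nonzero nested bracket involves no central `h_{r_a}`, which bounds the times from below by
    -- `dc`. It also excludes the central `h_0` as starting vector, so `reorder` turns `i < r_a`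
    -- into the upper bound.
    by_cases hz : nestedAd b (reorder n i) r = 0
    · rw [hz, TensorProduct.tmul_zero]
      exact Submodule.zero_mem _
    · refine tmul_mem_timePolyIn (Subalgebra.prod_mem _ fun a _ => ?_) _
      rw [MvPolynomial.rename_X, MvPolynomial.X_mem_supported, reorder_symm, Set.mem_ofPred_eq,
        Fin.lt_def]
      have hra := (Finset.mem_filter.mp hr).2.2 a
      have hra' := Fin.lt_def.mp hra
      constructor
      · by_contra hlt
        have hcen := (hb.deformationHypotheses hε hn).center_eq.ge
          (Submodule.subset_span ⟨reorder n (r a), not_le.mp hlt, rfl⟩)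
        rw [hb', reorder_reorder] at hcen
        exact hz (foldl_lie_eq_zero_of_mem ((List.mem_ofFn' _ _).mpr ⟨a, rfl⟩) hcen _)
      · have hi0 : (reorder n i).val ≠ 0 := fun hi0 => hz (nestedAd_eq_zero_of_lie_eq_zero
          (fun j _ => hb.lie_eq_zero (Or.inl hi0)) (by have := a.isLt; omega)
          (Finset.mem_filter.mp hr).2.2)
        rw [reorder_val] at hi0 hra' ⊢
        split_ifs at hi0 hra' ⊢ <;> omega
  · rw [toOriginalOrder_apply, Equiv.symm_symm, adExpansion_eq_of_lie_eq_zero, renameTimes_tmul,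
      map_one, hb']
    intro j hj
    have hj' := Fin.lt_def.mp hj
    have hv := reorder_val i
    refine hb.lie_eq_zero ?_
    split_ifs at hv <;> omega
  · rw [toOriginalOrder_apply, Equiv.symm_symm, atZero_renameTimes, atZero_adExpansion, hb']

theorem HasQsConst.eq_of_isMultiTimeDeformation (hb : HasQsConst ε b) (hε : ε = 0 ∨ ε = 1)
    (hn : 2 ≤ n) {H : Fin n → TimePoly n L}
    (hH : IsMultiTimeDeformation (b.reindex (reorder n).symm) (centerDim n (n + ε))
      ((n + ε) / 2 + 1) H) :
    toOriginalOrder (reorder n) H = adExpansion b (expCoeff n) n := by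
  have hb' : ∀ i, b.reindex (reorder n).symm i = b (reorder n i) := fun i => by simp
  refine (hH.frobenius.toOriginalOrder _).eq_of_atZero_eq hb.frobeniusCondition (fun i j hij => ?_)
    (fun i j hij => timeDeriv_adExpansion _ _ _ hij) fun i => ?_
  · rw [toOriginalOrder_apply, reorder_symm]
    nth_rewrite 1 [← reorder_reorder i]
    rw [timeDeriv_renameTimes, timeDeriv_eq_zero_of_mem (hH.mem _), map_zero]
    rw [Set.mem_ofPred_eq, Fin.lt_def]
    -- `1 ≤ dc` is needed for the time of index `0`, which `reorder` fixes; for the others the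
    -- reversal of order suffices.
    have h1 := (hb.deformationHypotheses hε hn).one_le_dc
    have hij' := Fin.le_def.mp hij
    rw [reorder_val, reorder_val]
    split_ifs <;> omega
  · rw [toOriginalOrder_apply, atZero_renameTimes, atZero_adExpansion, reorder_symm]
    by_cases hi : (reorder n i).val < (n + ε) / 2 + 1
    · rw [hH.undeformed _ hi, hb', reorder_reorder]
      simp [atZero]
    · rw [hH.initial _ (not_lt.mp hi), hb', reorder_reorder]

/-- The expansion with any constants has value `h_i` at `t = 0` and involves only later times, so
uniqueness applies; a nonzero nested bracket can then be cancelled from the coefficient. -/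
theorem HasQsConst.coeff_eq_of_frobeniusCondition (hb : HasQsConst ε b)
    {β : (k : ℕ) → Fin n → (Fin k → Fin n) → ℝ} {N : ℕ} (hN : n ≤ N)
    (hβ : FrobeniusCondition (adExpansion b β N)) {k : ℕ} {i : Fin n} {r : Fin k → Fin n}
    (hk : 2 ≤ k) (hr : Monotone r) (hir : ∀ a, i < r a) (hz : nestedAd b i r ≠ 0) :
    β k i r = expCoeff n k i r := by
  have heq : adExpansion b β N = adExpansion b (expCoeff n) N := by
    rw [← hb.adExpansion_congr hN]
    exact hβ.eq_of_atZero_eq hb.frobeniusCondition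
      (fun i j hij => timeDeriv_adExpansion _ _ _ hij)
      (fun i j hij => timeDeriv_adExpansion _ _ _ hij)
      fun i => by rw [atZero_adExpansion, atZero_adExpansion]
  have hkN : k ≤ N := by
    by_contra hkN
    exact hz (hb.nestedAd_eq_zero (by omega) hir)
  have h1 := congrArg (tcoeff (timesExponent r)) (congrFun heq i)
  rw [tcoeff_adExpansion _ _ i hkN hr hir, tcoeff_adExpansion _ _ i hkN hr hir] at h1
  have h2 := smul_left_injective ℝ hz h1
  simp only [if_neg (by omega : ¬ k ≤ 1)] at h2
  exact mul_left_cancel₀ (pow_ne_zero _ (by norm_num)) h2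

end Deformation

end

/-! ### Assembly -/

theorem mainTheorem3 (n m : ℕ) (hn : 2 ≤ n) (hm : m = n ∨ m = n + 1)
    (U : TopologicalSpace.Opens (PhaseSpace n)) (hU : (U : Set (PhaseSpace n)).Nonempty)
    (hdist : ∀ x ∈ U, Function.Injective x.1) :
    ∃ (𝔤 : LieSubalgebra ℝ (SmoothFun U)) (b : Module.Basis (Fin n) ℝ 𝔤),
      𝔤.toSubmodule = Submodule.span ℝ (Set.range (qsHam m U hdist)) ∧
      (∀ i, (b i : SmoothFun U) = qsHam m U hdist i) ∧
      DeformationHypotheses (b.reindex (reorder n).symm) (centerDim n m) (m / 2 + 1) ∧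
      ∃ H' : Fin n → TimePoly n 𝔤,
        IsMultiTimeDeformation (b.reindex (reorder n).symm) (centerDim n m) (m / 2 + 1) H' ∧
        (∀ H'' : Fin n → TimePoly n 𝔤,
          IsMultiTimeDeformation (b.reindex (reorder n).symm) (centerDim n m) (m / 2 + 1) H'' →
            H'' = H') ∧
        FrobeniusCondition (toOriginalOrder (reorder n) H') ∧
        (∀ (k : ℕ) (i : Fin n) (r : Fin k → Fin n), n < k → Monotone r → (∀ a, i < r a) →
          nestedAd b i r = 0) ∧
        ∃ α : (k : ℕ) → Fin n → (Fin k → Fin n) → ℝ,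
          (∀ N, n ≤ N → toOriginalOrder (reorder n) H' = adExpansion b α N) ∧
          ∀ (β : (k : ℕ) → Fin n → (Fin k → Fin n) → ℝ) (N : ℕ), n ≤ N →
            FrobeniusCondition (adExpansion b β N) →
            ∀ (k : ℕ) (i : Fin n) (r : Fin k → Fin n), 2 ≤ k → Monotone r →
              (∀ a, i < r a) → nestedAd b i r ≠ 0 → β k i r = α k i r := by
  obtain ⟨ε, hε, rfl⟩ : ∃ ε, (ε = 0 ∨ ε = 1) ∧ m = n + ε := by
    rcases hm with rfl | rfl
    · exact ⟨0, Or.inl rfl, rfl⟩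
    · exact ⟨1, Or.inr rfl, rfl⟩
  obtain ⟨p, rfl⟩ := Nat.exists_eq_add_of_le' hn
  have hb : HasQsConst ε (qsBasis hε hU hdist) := lie_qsBasis hε hU hdist
  have horder := toOriginalOrder_symm (reorder (p + 2))
    (adExpansion (qsBasis hε hU hdist) (expCoeff (p + 2)) (p + 2))
  refine ⟨qsLieSubalgebra hε hdist, qsBasis hε hU hdist, rfl, coe_qsBasis hε hU hdist,
    hb.deformationHypotheses hε hn, _, hb.isMultiTimeDeformation hε hn, fun H hH => ?_, ?_,
    fun k i r hk _ hr => hb.nestedAd_eq_zero hk hr, expCoeff (p + 2), fun N hN => ?_,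
    fun β N hN hβ k i r hk hr hir hz => hb.coeff_eq_of_frobeniusCondition hN hβ hk hr hir hz⟩
  · rw [← hb.eq_of_isMultiTimeDeformation hε hn hH]
    exact (toOriginalOrder_symm (reorder (p + 2)).symm H).symm
  · rw [horder]
    exact hb.frobeniusCondition
  · rw [horder]
    exact hb.adExpansion_congr hN
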